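/- **Setting.** Let $\theta_k$ be a Markov chain on $\mathcal N=\{1,\dots,\nu\}$ with irreducible, aperiodic transition matrix $P=(p_{ij})$, and consider $x_{k+1}=f(x_k,u_k,\theta_k)$ on $\mathbb R^n$, with inputs in $\mathbb R^m$, constraints $(x_k,u_k)\in Y_{\theta_k}$ and stage cost $\ell(x,u,\theta)$. For each $\theta$ let $f(\cdot,\cdot,\theta)$ be continuous, let $Y_\theta$ be nonempty and compact, and let $\ell(\cdot,\cdot,\theta)$ be nonnegative, lower semicontinuous and level-bounded in $u$ locally uniformly in $x$. Assume that for every mode $\theta$ the point $(0,0)$ minimizes $\ell(\cdot,\cdot,\theta)$ over $\{(x,u)\in Y_\theta: f(x,u,\theta)=x\}$ (and belongs to this set), and that $f(\cdot,\cdot,\theta)$ is differentiable at $(0,0)$; put $A_i=\partial_x f(0,0,i)$, $B_i=\partial_u f(0,0,i)$. A system $x_{k+1}=F(x_k,\theta_k)$ is mean square stable on a family $D=\{D_i\}_{i\in\mathcal N}$ if $\mathbb E\|x_k\|^2\to0$ for all $\theta_0=i$ and $x_0\in D_i$; $D$ is uniformly positive invariant (UPI) if all $D_i$ are nonempty and $F(x,i)\in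 D_j$ whenever $x\in D_i$ and $p_{ij}>0$. For $V:\mathbb R^n\times\mathcal N\to\mathbb R$ write $\mathcal LV(x,i)=\mathbb E[V(x_{k+1},\theta_{k+1})-V(x_k,\theta_k)\mid x_k=x,\theta_k=i]$, and for a family $(T_j)_{j\in\mathcal N}$ write $\mathscr E_i(T)=\sum_j p_{ij}T_j$. Let $\kappa_f(x,i)=K_ix$, where the gains $K_i$ stabilize the linearization in mean square, i.e. $z_{k+1}=\Gamma_{\theta_k}z_k$ with $\Gamma_i=A_i+B_iK_i$ is mean square stable (for all initial states and modes). Let $\hat f_i(x)=f(x,K_ix,i)$ be $\beta_f^i$-smooth and $\bar\ell(x,i)=\ell(x,K_ix,i)-\ell(0,0,i)$ be $\beta_\ell^i$-smooth (differentiable on $\mathbb R^n$ with Lipschitz derivative of that constant). For $\alpha>0$ put $q_i=\nabla\bar\ell(0,i)$, $\ell_q(x,i)=\tfrac12(\alpha+\beta_\ell^i)\|x\|^2+q_i^\top x$ and $$V_f(x,i)=\mathbb E\Big[\sum_{k\ge0}\ell_q(x_k,\theta_k)\Big],\qquad x_{k+1}=\Gamma_{\theta_k}x_k,\ x_0=x,\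 \theta_0=i .$$ **Theorem.** (a) There are positive semidefinite matrices $P^I_i,P^\beta_i$ and vectors $p_i$ with $P^I_i=I+\Gamma_i^\top\mathscr E_i(P^I)\Gamma_i$, $P^\beta_i=\beta^i_\ell I+\Gamma_i^\top\mathscr E_i(P^\beta)\Gamma_i$ and $p_i=q_i+\Gamma_i^\top\mathscr E_i(p)$ such that for every $\alpha>0$ the series defining $V_f$ converges almost surely to an integrable limit and $V_f(x,i)=\tfrac12x^\top(P^\beta_i+\alpha P^I_i)x+p_i^\top x$. (b) There are $\delta>0$ and $\alpha_0>0$ such that for every $\alpha\ge\alpha_0$, along $x_{k+1}=\hat f_{\theta_k}(x_k)$, $\mathcal LV_f(x,i)\le-\bar\ell(x,i)$ for all $i\in\mathcal N$ and all $\|x\|<\delta$. (c) With these $\delta$ and $\alpha\ge\alpha_0$, let $X^f=\{X^f_i\}$ be UPI for $x_{k+1}=\hat f_{\theta_k}(x_k)$, with $X^f_i\subseteq\{\|x\|<\delta\}$ and $(x,K_ix)\in Y_i$ for $x\in X^f_i$. Suppose that the system is strictly stochastically dissipative: there are $\lambda,\rho:\mathbb R^n\times\mathcal N\to\mathbb R$,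 with $\lambda(\cdot,i)$ lower semicontinuous, $\lambda(0,i)$ independent of $i$, $\rho(\cdot,i)$ convex, $\rho(0,i)=0$ and $\rho(x,i)>0$ for $x\ne0$, such that $$\sum_j p_{ij}\lambda(f(x,u,i),j)-\lambda(x,i)\le\ell(x,u,i)-\ell(0,0,i)-\rho(x,i)\quad\text{for all }(x,u)\in Y_i;$$ and suppose that $\rho(x,i)\ge\gamma\|x\|^2$ for all $x$ and $i$, with some $\gamma>0$. Then the controlled system is locally mean square stable, in the following sense. The system $x_{k+1}=f(x_k,\kappa_f(x_k,\theta_k),\theta_k)$ is mean square stable on $X^f$. Moreover, for every horizon $N\ge1$ let $X_{N,i}$ be the set of $x$ for which the problem of minimizing $$\mathbb E\Big[V_f(x_N,\theta_N)+\sum_{k<N}\ell(x_k,u_k,\theta_k)\Big]$$ over causal policies ($u_k$ a function of $\theta_0,\dots,\theta_k$), subject to the dynamics, $(x_0,\theta_0)=(x,i)$ and, almost surely, $(x_k,u_k)\in Y_{\theta_k}$ for $k<N$ and $x_N\in X^f_{\theta_N}$, is feasible. Then $X^f_i\subseteq X_{N,i}$, and for every receding horizon law $\hat\kappa_N$ (whose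 value at each $(x,i)$ with $x\in X_{N,i}$ is the first input of an optimizer) $\{X_{N,i}\}_i$ is UPI for the closed loop $x_{k+1}=f(x_k,\hat\kappa_N(x_k,\theta_k),\theta_k)$, which is mean square stable on $\{X_{N,i}\}_i$. -/

import Mathlib

open MeasureTheory ProbabilityTheory Filter Topology
open scoped NNReal ENNReal

noncomputable section

namespace EMPC

/-- `ℝⁿ` with its Euclidean norm. -/
abbrev Vec (n : ℕ) : Type := EuclideanSpace ℝ (Fin n)

/-- Mode sequences `(θ₀, θ₁, …)`; the mode process is the coordinate process `θ_k(ω) = ω k`. -/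
abbrev ModePath (ν : ℕ) : Type := ℕ → Fin ν

section MarkovChain

variable {ν : ℕ}

/-- The law of the next mode given the current mode `i`: the `i`-th row of `P`. -/
def stepPMF (P : Matrix.rowStochastic ℝ (Fin ν)) (i : Fin ν) : PMF (Fin ν) :=
  PMF.ofFintype (fun j => ENNReal.ofReal (P.1 i j)) (by
    rw [← ENNReal.ofReal_sum_of_nonneg
      (fun j _ => Matrix.nonneg_of_mem_rowStochastic P.2),
      Matrix.sum_row_of_mem_rowStochastic P.2, ENNReal.ofReal_one])

/-- The transition kernel from the history `(θ₀, …, θ_k)` to `θ_{k+1}`. -/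
def stepKernel (P : Matrix.rowStochastic ℝ (Fin ν)) (k : ℕ) :
    Kernel (Π _ : Finset.Iic k, Fin ν) (Fin ν) :=
  Kernel.ofFunOfCountable (fun h => (stepPMF P (h ⟨k, Finset.mem_Iic.2 le_rfl⟩)).toMeasure)

instance (P : Matrix.rowStochastic ℝ (Fin ν)) (k : ℕ) : IsMarkovKernel (stepKernel P k) :=
  ⟨fun h => by
    change IsProbabilityMeasure ((stepPMF P (h ⟨k, Finset.mem_Iic.2 le_rfl⟩)).toMeasure)
    infer_instance⟩

/-- The law on path space of the Markov chain with transition matrix `P` started in `θ₀ = i`. -/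
def chainLaw (P : Matrix.rowStochastic ℝ (Fin ν)) (i : Fin ν) : Measure (ModePath ν) :=
  Kernel.traj (X := fun _ : ℕ => Fin ν) (stepKernel P) 0 (fun _ => i)

instance (P : Matrix.rowStochastic ℝ (Fin ν)) (i : Fin ν) :
    IsProbabilityMeasure (chainLaw P i) := by
  unfold chainLaw
  infer_instance

/-- The finite-dimensional distributions of `chainLaw P i`. -/
theorem chainLaw_cylinder (P : Matrix.rowStochastic ℝ (Fin ν)) (i : Fin ν) (s : ModePath ν)
    (hs : s 0 = i) (n : ℕ) :
    chainLaw P i {ω | ∀ k ≤ n, ω k = s k} =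
      ENNReal.ofReal (∏ k ∈ Finset.range n, P.1 (s k) (s (k + 1))) := by
  have hset : ∀ n : ℕ, {ω : ModePath ν | ∀ k ≤ n, ω k = s k} =
      Preorder.frestrictLe (π := fun _ : ℕ => Fin ν) n ⁻¹'
        {Preorder.frestrictLe (π := fun _ : ℕ => Fin ν) n s} := by
    intro n
    ext ω
    simp [funext_iff]
  have hpart : ∀ n : ℕ, chainLaw P i {ω | ∀ k ≤ n, ω k = s k} =
      Kernel.partialTraj (X := fun _ : ℕ => Fin ν) (stepKernel P) 0 n (fun _ => i)
        {Preorder.frestrictLe (π := fun _ : ℕ => Fin ν) n s} := by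
    intro n
    rw [← Kernel.traj_map_frestrictLe_apply, Measure.map_apply (by fun_prop) (by measurability),
      ← hset, chainLaw]
  induction n with
  | zero =>
    rw [hpart, Kernel.partialTraj_self]
    have : Preorder.frestrictLe (π := fun _ : ℕ => Fin ν) 0 s = fun _ => i := by
      funext k
      obtain ⟨k, hk⟩ := k
      have : k = 0 := by simpa using hk
      subst this
      exact hs
    rw [this]
    simp [Kernel.id_apply]
  | succ n ih =>
    have h1 : {ω : ModePath ν | ∀ k ≤ n + 1, ω k = s k} =
        (fun x : ModePath ν => (Preorder.frestrictLe (π := fun _ : ℕ => Fin ν) n x, x (n + 1))) ⁻¹'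
          ({Preorder.frestrictLe (π := fun _ : ℕ => Fin ν) n s} ×ˢ {s (n + 1)}) := by
      ext ω
      have := Set.ext_iff.1 (hset n) ω
      simp only [Set.mem_ofPred_eq, Set.mem_preimage, Set.mem_singleton_iff] at this
      simp only [Set.mem_ofPred_eq, Set.mem_preimage, Set.mem_prod, Set.mem_singleton_iff, ← this]
      exact ⟨fun h => ⟨fun k hk => h k (by omega), h _ le_rfl⟩,
        fun h k hk => (Nat.le_succ_iff.1 hk).elim (h.1 k) (fun e => e ▸ h.2)⟩
    rw [h1, chainLaw, ← Measure.map_apply (by fun_prop) (by measurability),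
      ← Kernel.partialTraj_compProd_eq_map_traj (Nat.zero_le n),
      Measure.compProd_apply_prod (by measurability) (by measurability),
      lintegral_singleton, ← hpart, ih, Finset.prod_range_succ,
      ENNReal.ofReal_mul (Finset.prod_nonneg
        (fun k _ => Matrix.nonneg_of_mem_rowStochastic P.2)), mul_comm]
    congr 1
    change (stepPMF P (s n)).toMeasure {s (n + 1)} = _
    rw [PMF.toMeasure_apply_singleton _ _ (by measurability)]
    rfl

end MarkovChain

section Systems

variable {n m ν : ℕ}

/-- The trajectory of `x_{k+1} = F(x_k, θ_k)`, `x_0 = x`, along the mode sequence `ω`. -/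
def flow (F : Vec n → Fin ν → Vec n) (x : Vec n) (ω : ModePath ν) : ℕ → Vec n
  | 0 => x
  | k + 1 => F (flow F x ω k) (ω k)

/-- Mean square stability of `x_{k+1} = F(x_k, θ_k)` with domain of attraction `D`:
`𝔼‖x_k‖² → 0` for every initial mode `θ₀ = i` and every initial state `x₀ ∈ D i`. -/
def IsMSStableOn (P : Matrix.rowStochastic ℝ (Fin ν)) (F : Vec n → Fin ν → Vec n)
    (D : Fin ν → Set (Vec n)) : Prop :=
  ∀ i, ∀ x ∈ D i,
    Tendsto (fun k : ℕ => ∫ ω, ‖flow F x ω k‖ ^ 2 ∂(chainLaw P i)) atTop (𝓝 0)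

/-- Mean square stability (all initial states, all initial modes). -/
def IsMSStable (P : Matrix.rowStochastic ℝ (Fin ν)) (F : Vec n → Fin ν → Vec n) : Prop :=
  IsMSStableOn P F (fun _ => Set.univ)

/-- Uniform positive invariance of a family of nonempty sets for `x_{k+1} = F(x_k, θ_k)`. -/
def IsUPI (P : Matrix.rowStochastic ℝ (Fin ν)) (F : Vec n → Fin ν → Vec n)
    (C : Fin ν → Set (Vec n)) : Prop :=
  (∀ i, (C i).Nonempty) ∧ ∀ i j, 0 < P.1 i j → ∀ x ∈ C i, F x i ∈ C j

/-- `𝔼[V(x_{k+1}, θ_{k+1}) - V(x_k, θ_k) | x_k = x, θ_k = i]` when `x_{k+1} = y`. -/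
def drift (P : Matrix.rowStochastic ℝ (Fin ν)) (V : Vec n → Fin ν → ℝ) (y x : Vec n)
    (i : Fin ν) : ℝ :=
  ∫ ω, (V y (ω 1) - V x (ω 0)) ∂(chainLaw P i)

/-- The operator `𝓛` for `x_{k+1} = F(x_k, θ_k)`. -/
def generator (P : Matrix.rowStochastic ℝ (Fin ν)) (F : Vec n → Fin ν → Vec n)
    (V : Vec n → Fin ν → ℝ) (x : Vec n) (i : Fin ν) : ℝ :=
  drift P V (F x i) x i

/-- Average over the successor modes: `𝓔_i(T) = ∑_j p_{ij} T_j`. -/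
def modeAvg (P : Matrix.rowStochastic ℝ (Fin ν)) {M : Type*} [AddCommMonoid M] [Module ℝ M]
    (T : Fin ν → M) (i : Fin ν) : M :=
  ∑ j, P.1 i j • T j

/-- `β`-smoothness: differentiable with `β`-Lipschitz derivative. -/
def BetaSmooth {G : Type*} [NormedAddCommGroup G] [NormedSpace ℝ G] (β : ℝ≥0)
    (g : Vec n → G) : Prop :=
  Differentiable ℝ g ∧ LipschitzWith β (fderiv ℝ g)

/-- A function of `(x, u)` is level-bounded in `u` locally uniformly in `x`. -/
def LevelBoundedLocally (g : Vec n → Vec m → ℝ) : Prop :=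
  ∀ (c : ℝ) (x₀ : Vec n), ∃ W ∈ 𝓝 x₀,
    Bornology.IsBounded {p : Vec n × Vec m | p.1 ∈ W ∧ g p.1 p.2 ≤ c}

/-- Aperiodicity: for each mode the greatest common divisor of the possible return times is 1. -/
def IsAperiodic (P : Matrix (Fin ν) (Fin ν) ℝ) : Prop :=
  ∀ (i : Fin ν) (d : ℕ), (∀ k : ℕ, 1 ≤ k → 0 < (P ^ k) i i → d ∣ k) → d = 1

/-- The data of a constrained Markovian switching system with a stage cost: transition matrix `P`,
dynamics `x_{k+1} = f(x_k, u_k, θ_k)`, cost `ell(x, u, θ)`, constraints `(x_k, u_k) ∈ Y θ_k`. -/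
structure Plant (n m ν : ℕ) where
  P : Matrix.rowStochastic ℝ (Fin ν)
  f : Vec n → Vec m → Fin ν → Vec n
  ell : Vec n → Vec m → Fin ν → ℝ
  Y : Fin ν → Set (Vec n × Vec m)

namespace Plant

variable (S : Plant n m ν)

structure WellPosed : Prop where
  ell_nonneg : ∀ x u i, 0 ≤ S.ell x u i
  ell_lsc : ∀ i, LowerSemicontinuous (fun p : Vec n × Vec m => S.ell p.1 p.2 i)
  ell_levelBounded : ∀ i, LevelBoundedLocally (fun x u => S.ell x u i)
  f_continuous : ∀ i, Continuous (fun p : Vec n × Vec m => S.f p.1 p.2 i)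
  Y_nonempty : ∀ i, (S.Y i).Nonempty
  Y_compact : ∀ i, IsCompact (S.Y i)
  irreducible : S.P.1.IsIrreducible
  aperiodic : IsAperiodic S.P.1

/-- Admissible steady states of mode `i`. -/
def steadyStates (i : Fin ν) : Set (Vec n × Vec m) :=
  {p | S.f p.1 p.2 i = p.1 ∧ p ∈ S.Y i}

/-- The origin is an optimal steady state of every mode. -/
def CommonEquilibrium : Prop :=
  ∀ i, (0 : Vec n × Vec m) ∈ S.steadyStates i ∧
    IsMinOn (fun p : Vec n × Vec m => S.ell p.1 p.2 i) (S.steadyStates i) 0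

/-- Strict stochastic dissipativity with respect to the supply rate `ell(x, u, θ) - ell(0, 0, θ)`,
with storage function `lam` and with `rho` positive definite around the origin. -/
structure StrictlyDissipative (lam rho : Vec n → Fin ν → ℝ) : Prop where
  lam_lsc : ∀ i, LowerSemicontinuous (fun x => lam x i)
  lam_zero : ∀ i j, lam 0 i = lam 0 j
  rho_convex : ∀ i, ConvexOn ℝ Set.univ (fun x => rho x i)
  rho_zero : ∀ i, rho 0 i = 0
  rho_pos : ∀ i x, x ≠ 0 → 0 < rho x i
  dissipation : ∀ i x u, (x, u) ∈ S.Y i →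
    drift S.P lam (S.f x u i) x i ≤ S.ell x u i - S.ell 0 0 i - rho x i

/-- The system in closed loop with the state feedback `κ`. -/
def closedLoop (κ : Vec n → Fin ν → Vec m) (x : Vec n) (i : Fin ν) : Vec n :=
  S.f x (κ x i) i

/-- `A_i = ∂f_i/∂x (0, 0)`. -/
def A (i : Fin ν) : Vec n →L[ℝ] Vec n := fderiv ℝ (fun x => S.f x 0 i) 0

/-- `B_i = ∂f_i/∂u (0, 0)`. -/
def B (i : Fin ν) : Vec m →L[ℝ] Vec n := fderiv ℝ (fun u => S.f 0 u i) 0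

/-- The linear terminal control law `κ_f(x, i) = K_i x`. -/
def kappaF (K : Fin ν → (Vec n →L[ℝ] Vec m)) (x : Vec n) (i : Fin ν) : Vec m := K i x

/-- The shifted stage cost under the terminal law. -/
def ellBar (K : Fin ν → (Vec n →L[ℝ] Vec m)) (x : Vec n) (i : Fin ν) : ℝ :=
  S.ell x (kappaF K x i) i - S.ell 0 0 i

/-- `Γ_i = A_i + B_i K_i`. -/
def Gamma (K : Fin ν → (Vec n →L[ℝ] Vec m)) (i : Fin ν) : Vec n →L[ℝ] Vec n :=
  S.A i + (S.B i).comp (K i)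

/-- The gains `K` stabilize the linearization `z_{k+1} = A_{θ_k} z_k + B_{θ_k} u_k` in the mean
square sense. -/
def IsMSStabilizing (K : Fin ν → (Vec n →L[ℝ] Vec m)) : Prop :=
  IsMSStable S.P (fun z i => S.Gamma K i z)

/-- `q_i = ∇ellBar(0, i)`. -/
def q (K : Fin ν → (Vec n →L[ℝ] Vec m)) (i : Fin ν) : Vec n :=
  gradient (fun x => S.ellBar K x i) 0

/-- `ℓ_q(x, i) = ½ xᵀ (α + β_i) x + q_iᵀ x`. -/
def ellQ (K : Fin ν → (Vec n →L[ℝ] Vec m)) (β : Fin ν → ℝ≥0) (α : ℝ) (x : Vec n)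
    (i : Fin ν) : ℝ :=
  1 / 2 * inner ℝ x ((α + β i) • x) + inner ℝ (S.q K i) x

/-- The terms of the series defining the terminal cost, along the linear closed loop
`x_{k+1} = Γ_{θ_k} x_k`. -/
def costTerm (K : Fin ν → (Vec n →L[ℝ] Vec m)) (β : Fin ν → ℝ≥0) (α : ℝ) (x : Vec n)
    (ω : ModePath ν) (k : ℕ) : ℝ :=
  S.ellQ K β α (flow (fun z i => S.Gamma K i z) x ω k) (ω k)

/-- The terminal cost `V_f(x, i) = 𝔼[∑_k ℓ_q(x_k, θ_k) | x₀ = x, θ₀ = i]`. -/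
def Vf (K : Fin ν → (Vec n →L[ℝ] Vec m)) (β : Fin ν → ℝ≥0) (α : ℝ) (x : Vec n)
    (i : Fin ν) : ℝ :=
  ∫ ω, ∑' k, S.costTerm K β α x ω k ∂(chainLaw S.P i)

/-- The state trajectory under the input process `u`. -/
def openLoop (x : Vec n) (u : ℕ → ModePath ν → Vec m) (ω : ModePath ν) : ℕ → Vec n
  | 0 => x
  | k + 1 => S.f (openLoop x u ω k) (u k ω) (ω k)

/-- Feasibility of the control policy `u` for the horizon-`N` problem with terminal sets `Xf` and
initial condition `(x₀, θ₀) = (x, i)`: causality and (almost sure) constraint satisfaction. Only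
`u_0, …, u_{N-1}` matter. -/
structure Feasible (N : ℕ) (Xf : Fin ν → Set (Vec n)) (x : Vec n) (i : Fin ν)
    (u : ℕ → ModePath ν → Vec m) : Prop where
  causal : Adapted (Filtration.piLE (X := fun _ : ℕ => Fin ν)) u
  stage : ∀ᵐ ω ∂(chainLaw S.P i), ∀ k < N, (S.openLoop x u ω k, u k ω) ∈ S.Y (ω k)
  terminal : ∀ᵐ ω ∂(chainLaw S.P i), S.openLoop x u ω N ∈ Xf (ω N)

/-- The feasibility domain `X_N`. -/
def feasibleSet (N : ℕ) (Xf : Fin ν → Set (Vec n)) (i : Fin ν) : Set (Vec n) :=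
  {x | ∃ u, S.Feasible N Xf x i u}

/-- The cost `𝔼[V(x_N, θ_N) + ∑_{k<N} ell(x_k, u_k, θ_k)]` of a policy, terminal cost `V`. -/
def horizonCost (N : ℕ) (V : Vec n → Fin ν → ℝ) (x : Vec n) (i : Fin ν)
    (u : ℕ → ModePath ν → Vec m) : ℝ :=
  ∫ ω, (V (S.openLoop x u ω N) (ω N) +
    ∑ k ∈ Finset.range N, S.ell (S.openLoop x u ω k) (u k ω) (ω k)) ∂(chainLaw S.P i)

/-- `u` is an optimizer of the horizon-`N` problem at `(x, i)`. -/
def IsOptimizer (N : ℕ) (V : Vec n → Fin ν → ℝ) (Xf : Fin ν → Set (Vec n)) (x : Vec n)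
    (i : Fin ν) (u : ℕ → ModePath ν → Vec m) : Prop :=
  S.Feasible N Xf x i u ∧ ∀ w, S.Feasible N Xf x i w →
    S.horizonCost N V x i u ≤ S.horizonCost N V x i w

/-- `κ` is a receding horizon control law: at each feasible `(x, i)` it applies the first input of
an optimizer. -/
def IsMPCLaw (N : ℕ) (V : Vec n → Fin ν → ℝ) (Xf : Fin ν → Set (Vec n))
    (κ : Vec n → Fin ν → Vec m) : Prop :=
  ∀ i, ∀ x ∈ S.feasibleSet N Xf i, ∃ u, S.IsOptimizer N V Xf x i u ∧
    ∀ᵐ ω ∂(chainLaw S.P i), u 0 ω = κ x i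

end Plant

end Systems

end EMPC

end

open EMPC

/-! For part (a), mean square stability of a Markov jump linear system is automatically exponential.
The second moments of the transition operators, summed over the initial modes (`flowMoment`), tend
to zero and are submultiplicative in time, hence decay geometrically (`exists_flowMoment_le`), and
first moments decay with them. So the matrix and vector series for `lyapOp` and `lyapVec` converge.
Splitting off their first term by conditioning on the first transition gives the coupled equations,
and Fubini identifies `Vf` with the resulting quadratic-plus-linear function.

For part (b), replace Γ_i x by f̂_i(x), which differs from it by O(‖x‖²). The quadratic forms then
change by O(‖x‖³), the linear form by O(‖x‖²). On a small ball the P^I form still decreases by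
‖x‖²/2, and a large multiple α of this decrease absorbs every remaining O(‖x‖²) error
(`exists_terminal_decrease`).

For part (c), both closed loops are treated by one Lyapunov criterion (`isMSStableOn_of_lyapunov`):
a function bounded below on an invariant family whose expected decrease is at least γ‖x‖² makes the
second moments summable. For the terminal law the function is the P^I form. For the receding horizon
law it is the optimal cost minus the expected cost of staying at the equilibrium over the horizon,
plus the storage function λ. The tail of an optimal policy, extended by one step of the terminal
law, is feasible at the next state. By (b) it bounds the next optimal cost, and dissipativity turns
the stage cost that was paid into a decrease by ρ ≥ γ‖x‖². The equilibrium cost is subtracted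
because ℓ(0,0,i) varies with the mode. -/

namespace EMPC

/-! ### First-step decomposition of the chain law. -/

section Chain

variable {ν : ℕ}

/-- The mode path that starts in `i` and continues with `ω`. -/
def consPath (i : Fin ν) (ω : ModePath ν) : ModePath ν
  | 0 => i
  | k + 1 => ω k

@[simp] theorem consPath_zero (i : Fin ν) (ω : ModePath ν) : consPath i ω 0 = i := rfl

@[simp] theorem consPath_succ (i : Fin ν) (ω : ModePath ν) (k : ℕ) :
    consPath i ω (k + 1) = ω k := rfl

theorem measurable_consPath (i : Fin ν) : Measurable (consPath i) := by
  refine measurable_pi_lambda _ fun k => ?_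
  cases k with
  | zero => exact measurable_const
  | succ k => exact measurable_pi_apply k

theorem transition_nonneg (P : Matrix.rowStochastic ℝ (Fin ν)) (i j : Fin ν) : 0 ≤ P.1 i j :=
  Matrix.nonneg_of_mem_rowStochastic P.2

theorem transition_sum (P : Matrix.rowStochastic ℝ (Fin ν)) (i : Fin ν) : ∑ j, P.1 i j = 1 :=
  Matrix.sum_row_of_mem_rowStochastic P.2 i

/-- The set of paths that agree with `s` up to time `n` is measurable. -/
theorem measurableSet_cylinder (s : ModePath ν) (n : ℕ) :
    MeasurableSet {ω : ModePath ν | ∀ k ≤ n, ω k = s k} := by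
  simp only [Set.ofPred_forall]
  exact MeasurableSet.iInter fun k => MeasurableSet.iInter fun _ =>
    measurableSet_eq_fun (measurable_pi_apply k) measurable_const

/-- Finite measures on path space are determined by the cylinders of initial segments. -/
theorem ext_of_cylinder {μ μ' : Measure (ModePath ν)} [IsFiniteMeasure μ] [IsFiniteMeasure μ']
    (h : ∀ (s : ModePath ν) (n : ℕ),
      μ {ω | ∀ k ≤ n, ω k = s k} = μ' {ω | ∀ k ≤ n, ω k = s k}) : μ = μ' := by
  have hμ' : IsProjectiveLimit (α := fun _ : ℕ => Fin ν) μ' (fun I : Finset ℕ =>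
      μ'.map (I.restrict (π := fun _ : ℕ => Fin ν))) := fun I => rfl
  refine IsProjectiveLimit.unique ?_ hμ'
  have hfam : IsProjectiveMeasureFamily (α := fun _ : ℕ => Fin ν) (fun I : Finset ℕ =>
      μ'.map (I.restrict (π := fun _ : ℕ => Fin ν))) := by
    intro I J hJI
    rw [Measure.map_map (by fun_prop) (by fun_prop)]
    rfl
  rw [isProjectiveLimit_nat_iff hfam]
  intro n
  refine Measure.ext_of_singleton fun a => ?_
  rw [Measure.map_apply (by fun_prop) (by measurability),
    Measure.map_apply (by fun_prop) (by measurability)]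
  by_cases hne : ∃ s : ModePath ν, Preorder.frestrictLe (π := fun _ : ℕ => Fin ν) n s = a
  · obtain ⟨s, rfl⟩ := hne
    have hset : {ω : ModePath ν | ∀ k ≤ n, ω k = s k} =
        Preorder.frestrictLe (π := fun _ : ℕ => Fin ν) n ⁻¹'
          {Preorder.frestrictLe (π := fun _ : ℕ => Fin ν) n s} := by
      ext ω
      simp [funext_iff]
    have := h s n
    rw [hset] at this
    exact this
  · have : Preorder.frestrictLe (π := fun _ : ℕ => Fin ν) n ⁻¹' {a} = ∅ := by
      ext ω
      simpa using fun h => hne ⟨ω, h⟩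
    have h2 : (Finset.Iic n).restrict (π := fun _ : ℕ => Fin ν) ⁻¹' {a} = ∅ := this
    rw [this, h2]
    simp

theorem ae_mode_zero (P : Matrix.rowStochastic ℝ (Fin ν)) (i : Fin ν) :
    ∀ᵐ ω ∂(chainLaw P i), ω 0 = i := by
  have h := chainLaw_cylinder P i (fun _ => i) rfl 0
  simp only [nonpos_iff_eq_zero, forall_eq, Finset.range_zero, Finset.prod_empty,
    ENNReal.ofReal_one] at h
  exact (prob_compl_eq_zero_iff (measurableSet_eq_fun (measurable_pi_apply 0)
    measurable_const)).2 h

theorem chainLaw_cylinder_eq_zero (P : Matrix.rowStochastic ℝ (Fin ν)) (i : Fin ν)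
    (s : ModePath ν) (hs : s 0 ≠ i) (n : ℕ) :
    chainLaw P i {ω | ∀ k ≤ n, ω k = s k} = 0 := by
  refine measure_mono_null (fun ω hω => ?_) (ae_mode_zero P i)
  simp only [Set.mem_compl_iff, Set.mem_ofPred_eq] at hω ⊢
  rw [hω 0 (Nat.zero_le n)]
  exact hs

/-- First-step decomposition of the law of the chain. -/
theorem chainLaw_eq_sum (P : Matrix.rowStochastic ℝ (Fin ν)) (i : Fin ν) :
    chainLaw P i =
      ∑ j, ENNReal.ofReal (P.1 i j) • (chainLaw P j).map (consPath i) := by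
  have hfin : IsFiniteMeasure
      (∑ j, ENNReal.ofReal (P.1 i j) • (chainLaw P j).map (consPath i)) := by
    constructor
    rw [Measure.finsetSum_apply]
    refine ENNReal.sum_lt_top.2 fun j _ => ?_
    rw [Measure.smul_apply, smul_eq_mul]
    exact ENNReal.mul_lt_top ENNReal.ofReal_lt_top (measure_lt_top _ _)
  refine ext_of_cylinder fun s n => ?_
  rw [Measure.finsetSum_apply]
  simp only [Measure.smul_apply, smul_eq_mul,
    Measure.map_apply (measurable_consPath i) (measurableSet_cylinder s n)]
  by_cases hs : s 0 = i
  · rw [chainLaw_cylinder P i s hs]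
    cases n with
    | zero =>
      have : consPath i ⁻¹' {ω : ModePath ν | ∀ k ≤ 0, ω k = s k} = Set.univ := by
        ext ω
        simp [hs]
      rw [this]
      simp only [measure_univ, mul_one]
      rw [← ENNReal.ofReal_sum_of_nonneg (fun j _ => transition_nonneg P i j), transition_sum]
      simp
    | succ n =>
      have : consPath i ⁻¹' {ω : ModePath ν | ∀ k ≤ n + 1, ω k = s k} =
          {ω | ∀ k ≤ n, ω k = s (k + 1)} := by
        ext ω
        simp only [Set.mem_preimage, Set.mem_ofPred_eq]
        constructor
        · intro h k hk
          exact h (k + 1) (by omega)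
        · intro h k hk
          cases k with
          | zero => exact hs.symm
          | succ k => exact h k (by omega)
      -- A chain started in `j ≠ s 1` gives the shifted cylinder mass zero.
      rw [this, Finset.sum_eq_single (s 1)]
      · rw [chainLaw_cylinder P (s 1) (fun k => s (k + 1)) rfl,
          ← ENNReal.ofReal_mul (transition_nonneg P _ _), Finset.prod_range_succ', mul_comm, hs]
      · intro j _ hj
        rw [chainLaw_cylinder_eq_zero P j (fun k => s (k + 1)) (fun h => hj h.symm), mul_zero]
      · simp
  · rw [chainLaw_cylinder_eq_zero P i s hs]
    have : consPath i ⁻¹' {ω : ModePath ν | ∀ k ≤ n, ω k = s k} = ∅ := by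
      ext ω
      simp only [Set.mem_preimage, Set.mem_ofPred_eq, Set.mem_empty_iff_false, iff_false]
      exact fun h => hs (h 0 (Nat.zero_le n)).symm
    simp [this]

/-- An almost sure property holds almost surely after the first transition. -/
theorem ae_consPath {P : Matrix.rowStochastic ℝ (Fin ν)} {i j : Fin ν} (hij : 0 < P.1 i j)
    {Q : ModePath ν → Prop} (h : ∀ᵐ ω ∂(chainLaw P i), Q ω) :
    ∀ᵐ ω ∂(chainLaw P j), Q (consPath i ω) := by
  rw [chainLaw_eq_sum P i] at h
  -- The `j`-th summand has positive weight, so null sets of the mixture are null for it.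
  have h1 : (chainLaw P j).map (consPath i) ≪
      ∑ j, ENNReal.ofReal (P.1 i j) • (chainLaw P j).map (consPath i) := by
    intro s hs
    rw [Measure.finsetSum_apply, Finset.sum_eq_zero_iff] at hs
    have := hs j (Finset.mem_univ j)
    rw [Measure.smul_apply, smul_eq_mul, mul_eq_zero] at this
    exact this.resolve_left (by simpa using hij)
  exact ae_of_ae_map (measurable_consPath i).aemeasurable (h1.ae_le h)

/-- A measurable property holds almost surely if it does so after every possible first
transition. -/
theorem ae_of_ae_consPath {P : Matrix.rowStochastic ℝ (Fin ν)} {i : Fin ν}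
    {Q : ModePath ν → Prop} (hQ : MeasurableSet {ω | Q ω})
    (h : ∀ j, 0 < P.1 i j → ∀ᵐ ω ∂(chainLaw P j), Q (consPath i ω)) :
    ∀ᵐ ω ∂(chainLaw P i), Q ω := by
  rw [chainLaw_eq_sum P i, ae_iff, Measure.finsetSum_apply]
  refine Finset.sum_eq_zero fun j _ => ?_
  rw [Measure.smul_apply, smul_eq_mul]
  rcases (transition_nonneg P i j).eq_or_lt with h0 | h0
  · simp [← h0]
  · have := h j h0
    rw [← ae_map_iff (measurable_consPath i).aemeasurable hQ, ae_iff] at this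
    rw [this, mul_zero]

/-- Almost surely only transitions of positive probability occur. -/
theorem ae_transition_pos (P : Matrix.rowStochastic ℝ (Fin ν)) (i : Fin ν) :
    ∀ᵐ ω ∂(chainLaw P i), ∀ k, 0 < P.1 (ω k) (ω (k + 1)) := by
  rw [ae_all_iff]
  intro k
  have hmeas : ∀ k : ℕ, MeasurableSet {ω : ModePath ν | 0 < P.1 (ω k) (ω (k + 1))} := fun k =>
    measurableSet_lt measurable_const
      (Measurable.comp (g := fun p : Fin ν × Fin ν => P.1 p.1 p.2)
        (f := fun ω : ModePath ν => (ω k, ω (k + 1))) (measurable_of_countable _)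
        ((measurable_pi_apply k).prodMk (measurable_pi_apply (k + 1))))
  induction k generalizing i with
  | zero =>
    refine ae_of_ae_consPath (hmeas 0) fun j hj => ?_
    filter_upwards [ae_mode_zero P j] with ω hω
    simpa [hω] using hj
  | succ k ih => exact ae_of_ae_consPath (hmeas (k + 1)) fun j _ => ih j

/-! ### Functions of finitely many modes, and the Markov property. -/

section FiniteDependence

variable {E : Type*}

/-- A function of finitely many modes factors through a finite type. -/
theorem exists_comp_frestrictLe {φ : ModePath ν → E} {k : ℕ} (hφ : DependsOn φ (Set.Iic k)) :
    ∃ (g : Set.range (Preorder.frestrictLe (π := fun _ : ℕ => Fin ν) k) → E),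
      φ = fun ω => g ⟨Preorder.frestrictLe k ω, ω, rfl⟩ := by
  refine ⟨fun a => φ a.2.choose, ?_⟩
  funext ω
  refine hφ fun l hl => ?_
  have h := (⟨Preorder.frestrictLe k ω, ω, rfl⟩ :
    Set.range (Preorder.frestrictLe (π := fun _ : ℕ => Fin ν) k)).2.choose_spec
  exact (congrFun h ⟨l, Finset.mem_Iic.2 hl⟩).symm

/-- There are finitely many histories up to time `k`, so every set of them is measurable. Causality
of a policy thus reduces to dependence on past modes. -/
theorem measurable_of_dependsOn [MeasurableSpace E] {φ : ModePath ν → E} {k : ℕ}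
    (hφ : DependsOn φ (Set.Iic k)) :
    Measurable[(Filtration.piLE (X := fun _ : ℕ => Fin ν)) k] φ := by
  intro s _
  refine ⟨Preorder.restrictLe k '' (φ ⁻¹' s), Set.toFinite _ |>.measurableSet, ?_⟩
  ext ω
  constructor
  · rintro ⟨ω', hω', h⟩
    have : φ ω = φ ω' := hφ fun l hl => (congrFun h ⟨l, hl⟩).symm
    simpa [this] using hω'
  · exact fun h => ⟨ω, h, rfl⟩

variable [NormedAddCommGroup E]

/-- Such a function takes finitely many values. Hence feedback laws, storage functions and costs
need no measurability assumption anywhere below. -/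
theorem integrable_of_dependsOn {φ : ModePath ν → E} {k : ℕ} (hφ : DependsOn φ (Set.Iic k))
    (μ : Measure (ModePath ν)) [IsFiniteMeasure μ] : Integrable φ μ := by
  obtain ⟨g, rfl⟩ := exists_comp_frestrictLe hφ
  have hm : Measurable (fun ω : ModePath ν => (⟨Preorder.frestrictLe k ω, ω, rfl⟩ :
      Set.range (Preorder.frestrictLe (π := fun _ : ℕ => Fin ν) k))) :=
    Measurable.subtype_mk (by fun_prop)
  exact (Integrable.of_finite (f := g)).comp_measurable hm

theorem DependsOn.consPath {E : Type*} {φ : ModePath ν → E} {k : ℕ}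
    (hφ : DependsOn φ (Set.Iic (k + 1))) (i : Fin ν) :
    DependsOn (fun ω => φ (consPath i ω)) (Set.Iic k) := by
  intro ω ω' h
  refine hφ fun l hl => ?_
  cases l with
  | zero => rfl
  | succ l => exact h l (Nat.succ_le_succ_iff.1 hl)

variable [NormedSpace ℝ E]

/-- First-step decomposition of expectations. -/
theorem integral_chainLaw {φ : ModePath ν → E} {k : ℕ} (hφ : DependsOn φ (Set.Iic k))
    (P : Matrix.rowStochastic ℝ (Fin ν)) (i : Fin ν) :
    ∫ ω, φ ω ∂(chainLaw P i) = ∑ j, P.1 i j • ∫ ω, φ (consPath i ω) ∂(chainLaw P j) := by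
  have hi : ∀ j, Integrable φ ((chainLaw P j).map (consPath i)) := fun j =>
    have : IsFiniteMeasure ((chainLaw P j).map (consPath i)) := inferInstance
    integrable_of_dependsOn hφ _
  rw [chainLaw_eq_sum P i, integral_finsetSum_measure
    (fun j _ => (hi j).smul_measure ENNReal.ofReal_ne_top)]
  refine Finset.sum_congr rfl fun j _ => ?_
  rw [integral_smul_measure, ENNReal.toReal_ofReal (transition_nonneg P i j),
    integral_map (measurable_consPath i).aemeasurable (hi j).aestronglyMeasurable]

theorem integral_mode_zero [CompleteSpace E] (P : Matrix.rowStochastic ℝ (Fin ν)) (i : Fin ν)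
    {φ : ModePath ν → E} {c : E} (hφ : ∀ ω, ω 0 = i → φ ω = c) :
    ∫ ω, φ ω ∂(chainLaw P i) = c := by
  have : φ =ᵐ[chainLaw P i] fun _ => c := (ae_mode_zero P i).mono hφ
  rw [integral_congr_ae this]
  simp

/-- Markov property: the expectation over the mode at time `k + 1`, given the first `k` modes. -/
theorem integral_markov [CompleteSpace E] (P : Matrix.rowStochastic ℝ (Fin ν)) (i : Fin ν)
    {k : ℕ} {Φ : Fin ν → ModePath ν → E} (hΦ : ∀ j, DependsOn (Φ j) (Set.Iic k)) :
    ∫ ω, Φ (ω (k + 1)) ω ∂(chainLaw P i) =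
      ∫ ω, ∑ j, P.1 (ω k) j • Φ j ω ∂(chainLaw P i) := by
  have hL : ∀ {k : ℕ} {Φ : Fin ν → ModePath ν → E}, (∀ j, DependsOn (Φ j) (Set.Iic k)) →
      DependsOn (fun ω => Φ (ω (k + 1)) ω) (Set.Iic (k + 1)) := by
    intro k Φ hΦ ω ω' h
    simp only [h (k + 1) (Set.mem_Iic.2 le_rfl)]
    exact hΦ _ fun l hl => h l (Set.mem_Iic.2 (le_trans hl (Nat.le_succ k)))
  have hR : ∀ {k : ℕ} {Φ : Fin ν → ModePath ν → E}, (∀ j, DependsOn (Φ j) (Set.Iic k)) →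
      DependsOn (fun ω => ∑ j, P.1 (ω k) j • Φ j ω) (Set.Iic k) := by
    intro k Φ hΦ ω ω' h
    simp only [h k (Set.mem_Iic.2 le_rfl)]
    exact Finset.sum_congr rfl fun j _ => by rw [hΦ j h]
  -- Each first-step decomposition moves the claim one time unit towards the start of the chain,
  -- changing the initial mode and prepending a mode inside `Φ`.
  induction k generalizing i Φ with
  | zero =>
    rw [integral_chainLaw (hL hΦ)]
    rw [integral_mode_zero P i (φ := fun ω => ∑ j, P.1 (ω 0) j • Φ j ω)
      (c := ∑ j, P.1 i j • Φ j (fun _ => i))]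
    · refine Finset.sum_congr rfl fun j _ => ?_
      rw [integral_mode_zero P j (c := Φ j (fun _ => i))]
      intro ω hω
      simp only [consPath_succ, hω]
      exact hΦ j fun l hl => by
        obtain rfl : l = 0 := Nat.le_zero.1 hl
        rfl
    · intro ω hω
      simp only [hω]
      refine Finset.sum_congr rfl fun j _ => ?_
      rw [hΦ j (x := ω) (y := fun _ => i) fun l hl => by
        obtain rfl : l = 0 := Nat.le_zero.1 hl
        exact hω]
  | succ k ih =>
    rw [integral_chainLaw (hL hΦ), integral_chainLaw (hR hΦ)]
    refine Finset.sum_congr rfl fun j _ => ?_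
    congr 1
    exact ih j (Φ := fun j ω => Φ j (consPath i ω)) fun j => (hΦ j).consPath i

end FiniteDependence

theorem drift_eq {n : ℕ} (P : Matrix.rowStochastic ℝ (Fin ν)) (V : Vec n → Fin ν → ℝ)
    (y x : Vec n) (i : Fin ν) : drift P V y x i = ∑ j, P.1 i j * V y j - V x i := by
  have hd : DependsOn (fun ω : ModePath ν => V y (ω 1) - V x (ω 0)) (Set.Iic 1) := by
    intro ω ω' h
    simp only [h 1 (Set.mem_Iic.2 le_rfl), h 0 (Set.mem_Iic.2 zero_le_one)]
  rw [drift, integral_chainLaw hd]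
  have : ∀ j, ∫ ω, (V y (consPath i ω 1) - V x (consPath i ω 0)) ∂(chainLaw P j) =
      V y j - V x i := fun j =>
    integral_mode_zero P j fun ω hω => by
      change V y (ω 0) - V x i = _
      rw [hω]
  simp only [this, smul_eq_mul, mul_sub, Finset.sum_sub_distrib, ← Finset.sum_mul,
    transition_sum, one_mul]

end Chain

/-! ### A Lyapunov criterion for mean square stability. -/

section Lyapunov

variable {n ν : ℕ}

/-- The state at time `k + 1` is fixed by the modes up to time `k`. So θ_{k+1} is the only new
randomness in W(x_{k+1}, θ_{k+1}), as `integral_markov` requires. -/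
theorem dependsOn_flow_succ (F : Vec n → Fin ν → Vec n) (x : Vec n) (k : ℕ) :
    DependsOn (fun ω => flow F x ω (k + 1)) (Set.Iic k) := by
  induction k with
  | zero =>
    intro ω ω' h
    simp only [flow, h 0 (Set.mem_Iic.2 le_rfl)]
  | succ k ih =>
    intro ω ω' h
    have h1 := ih fun l hl => h l (Set.mem_Iic.2 (le_trans hl (Nat.le_succ k)))
    change F (flow F x ω (k + 1)) (ω (k + 1)) = F (flow F x ω' (k + 1)) (ω' (k + 1))
    exact congrArg₂ F h1 (h (k + 1) (Set.mem_Iic.2 le_rfl))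

theorem dependsOn_flow (F : Vec n → Fin ν → Vec n) (x : Vec n) (k : ℕ) :
    DependsOn (fun ω => flow F x ω k) (Set.Iic k) := by
  cases k with
  | zero => exact fun _ _ _ => rfl
  | succ k =>
    exact (dependsOn_flow_succ F x k).mono (Set.Iic_subset_Iic.2 (Nat.le_succ k))

theorem dependsOn_flow_mode {E : Type*} (F : Vec n → Fin ν → Vec n) (x : Vec n)
    (g : Vec n → Fin ν → E) (k : ℕ) :
    DependsOn (fun ω => g (flow F x ω k) (ω k)) (Set.Iic k) := by
  intro ω ω' h
  have h1 := dependsOn_flow F x k h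
  simp only at h1
  simp only [h1, h k (Set.mem_Iic.2 le_rfl)]

/-- Trajectories that start in an invariant family almost surely stay in it. -/
theorem ae_flow_mem {P : Matrix.rowStochastic ℝ (Fin ν)} {F : Vec n → Fin ν → Vec n}
    {D : Fin ν → Set (Vec n)} (hD : ∀ i j, 0 < P.1 i j → ∀ x ∈ D i, F x i ∈ D j)
    {i : Fin ν} {x : Vec n} (hx : x ∈ D i) :
    ∀ᵐ ω ∂(chainLaw P i), ∀ k, flow F x ω k ∈ D (ω k) := by
  filter_upwards [ae_mode_zero P i, ae_transition_pos P i] with ω h0 hpos k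
  induction k with
  | zero => simpa [flow, h0] using hx
  | succ k ih => exact hD _ _ (hpos k) _ ih

/-- A Lyapunov criterion for mean square stability on an invariant family of sets. -/
theorem isMSStableOn_of_lyapunov {P : Matrix.rowStochastic ℝ (Fin ν)}
    {F : Vec n → Fin ν → Vec n} {D : Fin ν → Set (Vec n)}
    (hD : ∀ i j, 0 < P.1 i j → ∀ x ∈ D i, F x i ∈ D j)
    (W : Vec n → Fin ν → ℝ) {c γ : ℝ} (hγ : 0 < γ) (hc : ∀ i, ∀ x ∈ D i, c ≤ W x i)
    (hW : ∀ i, ∀ x ∈ D i, ∑ j, P.1 i j * W (F x i) j ≤ W x i - γ * ‖x‖ ^ 2) :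
    IsMSStableOn P F D := by
  intro i x hx
  have hmem := ae_flow_mem hD hx
  set a : ℕ → ℝ := fun k => ∫ ω, W (flow F x ω k) (ω k) ∂(chainLaw P i)
  set e : ℕ → ℝ := fun k => ∫ ω, ‖flow F x ω k‖ ^ 2 ∂(chainLaw P i) with he
  have hint : ∀ k, Integrable (fun ω => W (flow F x ω k) (ω k)) (chainLaw P i) := fun k =>
    integrable_of_dependsOn (dependsOn_flow_mode F x W k) _
  have hinte : ∀ k, Integrable (fun ω => ‖flow F x ω k‖ ^ 2) (chainLaw P i) := fun k =>
    integrable_of_dependsOn (dependsOn_flow_mode F x (fun y _ => ‖y‖ ^ 2) k) _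
  have hstep : ∀ k, a (k + 1) ≤ a k - γ * e k := by
    intro k
    have h1 : a (k + 1) = ∫ ω, ∑ j, P.1 (ω k) j • W (flow F x ω (k + 1)) j ∂(chainLaw P i) :=
      integral_markov P i (Φ := fun j ω => W (flow F x ω (k + 1)) j) fun j ω ω' h =>
        congrArg (W · j) (dependsOn_flow_succ F x k h)
    have h2 : a k - γ * e k =
        ∫ ω, (W (flow F x ω k) (ω k) - γ * ‖flow F x ω k‖ ^ 2) ∂(chainLaw P i) := by
      rw [integral_sub (hint k) ((hinte k).const_mul γ), integral_const_mul]
    rw [h1, h2]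
    refine integral_mono_ae ?_ ((hint k).sub ((hinte k).const_mul γ)) ?_
    · exact integrable_of_dependsOn (dependsOn_flow_mode F x
        (fun y i => ∑ j, P.1 i j • W (F y i) j) k) _
    · filter_upwards [hmem] with ω hω
      exact hW _ _ (hω k)
  have hlow : ∀ k, c ≤ a k := by
    intro k
    calc c = ∫ _, c ∂(chainLaw P i) := by simp
      _ ≤ a k := integral_mono_ae (integrable_const c) (hint k) (by
        filter_upwards [hmem] with ω hω
        exact hc _ _ (hω k))
  -- Telescoping, with the lower bound on `a T`, makes the second moments summable; in particular
  -- they tend to zero.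
  have hsum : ∀ T, γ * ∑ k ∈ Finset.range T, e k ≤ a 0 - a T := by
    intro T
    induction T with
    | zero => simp
    | succ T ih =>
      rw [Finset.sum_range_succ, mul_add]
      linarith [hstep T]
  have he0 : ∀ k, 0 ≤ e k := fun k => integral_nonneg fun ω => sq_nonneg _
  have hs : Summable e := by
    refine summable_of_sum_range_le (c := (a 0 - c) / γ) he0 fun T => ?_
    rw [le_div_iff₀ hγ, mul_comm]
    linarith [hsum T, hlow T]
  exact hs.tendsto_atTop_zero

end Lyapunov

/-! ### Exponential decay for mean square stable jump linear systems. -/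

section Linear

variable {n ν : ℕ} (Γ : Fin ν → (Vec n →L[ℝ] Vec n))

/-- The transition operator of `x_{k+1} = Γ_{θ_k} x_k` from time `0` to time `k`. -/
noncomputable def linFlow (ω : ModePath ν) : ℕ → (Vec n →L[ℝ] Vec n)
  | 0 => ContinuousLinearMap.id ℝ (Vec n)
  | k + 1 => (Γ (ω k)).comp (linFlow ω k)

theorem flow_eq_linFlow (x : Vec n) (ω : ModePath ν) (k : ℕ) :
    flow (fun z i => Γ i z) x ω k = linFlow Γ ω k x := by
  induction k with
  | zero => rfl
  | succ k ih => simp [flow, linFlow, ih]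

/-- The earliest step is the innermost factor, so prepending a mode composes on the right. -/
theorem linFlow_consPath (i : Fin ν) (ω : ModePath ν) (k : ℕ) :
    linFlow Γ (consPath i ω) (k + 1) = (linFlow Γ ω k).comp (Γ i) := by
  induction k with
  | zero => ext1 x; simp [linFlow]
  | succ k ih =>
    rw [linFlow, ih]
    rfl

theorem dependsOn_linFlow (k : ℕ) :
    DependsOn (fun ω => linFlow Γ ω k) (Set.Iic k) := by
  intro ω ω' h
  ext1 x
  simp only [← flow_eq_linFlow]
  exact dependsOn_flow _ x k h

theorem dependsOn_linFlow_mode {E : Type*} (g : (Vec n →L[ℝ] Vec n) → Fin ν → E) (k : ℕ) :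
    DependsOn (fun ω => g (linFlow Γ ω k) (ω k)) (Set.Iic k) := by
  intro ω ω' h
  have h1 := dependsOn_linFlow Γ k h
  simp only at h1
  simp only [h1, h k (Set.mem_Iic.2 le_rfl)]

/-- The operator norm is at most the Hilbert–Schmidt norm, by Cauchy–Schwarz. This passes from
stability for individual initial states to operator norms. -/
theorem sq_opNorm_le_sum (A : Vec n →L[ℝ] Vec n) :
    ‖A‖ ^ 2 ≤ ∑ a, ‖A (EuclideanSpace.basisFun (Fin n) ℝ a)‖ ^ 2 := by
  set s := ∑ a, ‖A (EuclideanSpace.basisFun (Fin n) ℝ a)‖ ^ 2 with hs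
  have hs0 : 0 ≤ s := Finset.sum_nonneg fun a _ => sq_nonneg _
  have h : ‖A‖ ≤ Real.sqrt s := by
    refine A.opNorm_le_bound (Real.sqrt_nonneg _) fun x => ?_
    have hx : A x = ∑ a, x a • A (EuclideanSpace.basisFun (Fin n) ℝ a) := by
      conv_lhs => rw [← (EuclideanSpace.basisFun (Fin n) ℝ).sum_repr x]
      simp
    calc ‖A x‖ ≤ ∑ a, ‖x a‖ * ‖A (EuclideanSpace.basisFun (Fin n) ℝ a)‖ := by
          rw [hx]
          refine (norm_sum_le _ _).trans_eq (Finset.sum_congr rfl fun a _ => norm_smul _ _)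
      _ ≤ Real.sqrt (∑ a, ‖x a‖ ^ 2) * Real.sqrt s := Real.sum_mul_le_sqrt_mul_sqrt _ _ _
      _ = Real.sqrt s * ‖x‖ := by rw [EuclideanSpace.norm_eq, mul_comm]
  calc ‖A‖ ^ 2 ≤ Real.sqrt s ^ 2 := by gcongr
    _ = s := Real.sq_sqrt hs0

variable (P : Matrix.rowStochastic ℝ (Fin ν))

/-- The sum over the initial modes of the second moments of the transition operators. -/
noncomputable def flowMoment (k : ℕ) : ℝ := ∑ i, ∫ ω, ‖linFlow Γ ω k‖ ^ 2 ∂(chainLaw P i)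

theorem integrable_linFlow {E : Type*} [NormedAddCommGroup E]
    (g : (Vec n →L[ℝ] Vec n) → Fin ν → E) (k : ℕ) (i : Fin ν) :
    Integrable (fun ω => g (linFlow Γ ω k) (ω k)) (chainLaw P i) :=
  integrable_of_dependsOn (dependsOn_linFlow_mode Γ g k) _

theorem flowMoment_nonneg (k : ℕ) : 0 ≤ flowMoment Γ P k :=
  Finset.sum_nonneg fun _ _ => integral_nonneg fun _ => sq_nonneg _

theorem integral_le_flowMoment (k : ℕ) (i : Fin ν) :
    ∫ ω, ‖linFlow Γ ω k‖ ^ 2 ∂(chainLaw P i) ≤ flowMoment Γ P k :=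
  Finset.single_le_sum (f := fun i => ∫ ω, ‖linFlow Γ ω k‖ ^ 2 ∂(chainLaw P i))
    (fun _ _ => integral_nonneg fun _ => sq_nonneg _) (Finset.mem_univ i)

theorem tendsto_flowMoment (h : IsMSStable P (fun z i => Γ i z)) :
    Tendsto (flowMoment Γ P) atTop (𝓝 0) := by
  have h1 : Tendsto (fun k => ∑ i, ∑ a, ∫ ω,
      ‖linFlow Γ ω k (EuclideanSpace.basisFun (Fin n) ℝ a)‖ ^ 2 ∂(chainLaw P i)) atTop (𝓝 0) := by
    rw [show (0 : ℝ) = ∑ _i : Fin ν, ∑ _a : Fin n, (0 : ℝ) by simp]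
    refine tendsto_finsetSum _ fun i _ => tendsto_finsetSum _ fun a _ => ?_
    have := h i (EuclideanSpace.basisFun (Fin n) ℝ a) (Set.mem_univ _)
    simpa only [flow_eq_linFlow] using this
  refine squeeze_zero (flowMoment_nonneg Γ P) (fun k => ?_) h1
  refine Finset.sum_le_sum fun i _ => ?_
  rw [← integral_finsetSum _ fun a _ => integrable_linFlow Γ P
    (fun A _ => ‖A (EuclideanSpace.basisFun (Fin n) ℝ a)‖ ^ 2) k i]
  exact integral_mono (integrable_linFlow Γ P (fun A _ => ‖A‖ ^ 2) k i)
    (integrable_linFlow Γ P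
      (fun A _ => ∑ a, ‖A (EuclideanSpace.basisFun (Fin n) ℝ a)‖ ^ 2) k i)
    fun ω => sq_opNorm_le_sum _

/-- The right factor `A` is carried for the induction: peeling off the first step replaces it by `(Γ
i).comp A`. At `k = 0` the remaining `l` steps are bounded uniformly in the current mode, since
`flowMoment` sums over all initial modes. -/
theorem integral_linFlow_comp_le (k l : ℕ) (A : Vec n →L[ℝ] Vec n) (i : Fin ν) :
    ∫ ω, ‖(linFlow Γ ω (k + l)).comp A‖ ^ 2 ∂(chainLaw P i) ≤
      flowMoment Γ P l * ∫ ω, ‖(linFlow Γ ω k).comp A‖ ^ 2 ∂(chainLaw P i) := by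
  induction k generalizing i A with
  | zero =>
    have h0 : ∫ ω, ‖(linFlow Γ ω 0).comp A‖ ^ 2 ∂(chainLaw P i) = ‖A‖ ^ 2 := by
      simp [linFlow]
    rw [h0, zero_add]
    calc ∫ ω, ‖(linFlow Γ ω l).comp A‖ ^ 2 ∂(chainLaw P i)
        ≤ ∫ ω, ‖linFlow Γ ω l‖ ^ 2 * ‖A‖ ^ 2 ∂(chainLaw P i) := by
          refine integral_mono (integrable_linFlow Γ P (fun B _ => ‖B.comp A‖ ^ 2) l i)
            (integrable_linFlow Γ P (fun B _ => ‖B‖ ^ 2 * ‖A‖ ^ 2) l i) fun ω => ?_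
          simp only [← mul_pow]
          gcongr
          exact ContinuousLinearMap.opNorm_comp_le _ _
      _ ≤ flowMoment Γ P l * ‖A‖ ^ 2 := by
          rw [integral_mul_const]
          gcongr
          exact integral_le_flowMoment Γ P l i
  | succ k ih =>
    rw [integral_chainLaw (dependsOn_linFlow_mode Γ (fun B _ => ‖B.comp A‖ ^ 2) (k + 1 + l)),
      integral_chainLaw (dependsOn_linFlow_mode Γ (fun B _ => ‖B.comp A‖ ^ 2) (k + 1)),
      Finset.mul_sum]
    refine Finset.sum_le_sum fun j _ => ?_
    rw [show k + 1 + l = (k + l) + 1 by omega]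
    simp only [linFlow_consPath, ContinuousLinearMap.comp_assoc, smul_eq_mul]
    rw [mul_left_comm]
    exact mul_le_mul_of_nonneg_left (ih _ j) (transition_nonneg P i j)

theorem flowMoment_add_le (k l : ℕ) :
    flowMoment Γ P (k + l) ≤ flowMoment Γ P l * flowMoment Γ P k := by
  rw [flowMoment, flowMoment.eq_1 Γ P k, Finset.mul_sum]
  refine Finset.sum_le_sum fun i _ => ?_
  simpa using integral_linFlow_comp_le Γ P k l (ContinuousLinearMap.id ℝ (Vec n)) i

/-- Mean square stability of a Markov jump linear system is exponential. -/
theorem exists_flowMoment_le (h : IsMSStable P (fun z i => Γ i z)) :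
    ∃ C r : ℝ, 0 ≤ C ∧ 0 ≤ r ∧ r < 1 ∧ ∀ k, flowMoment Γ P k ≤ (C * r ^ k) ^ 2 := by
  obtain ⟨L, hL1, hL⟩ : ∃ L, 1 ≤ L ∧ flowMoment Γ P L ≤ 1 / 4 := by
    have h1 := (tendsto_flowMoment Γ P h).eventually_lt_const (u := 1 / 4) (by norm_num)
    obtain ⟨L, hL1, hL⟩ := ((eventually_ge_atTop 1).and h1).exists
    exact ⟨L, hL1, hL.le⟩
  have hq : ∀ q s, flowMoment Γ P (L * q + s) ≤ (1 / 4) ^ q * flowMoment Γ P s := by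
    intro q s
    induction q with
    | zero => simp
    | succ q ih =>
      calc flowMoment Γ P (L * (q + 1) + s) = flowMoment Γ P ((L * q + s) + L) := by
            congr 1; ring
        _ ≤ flowMoment Γ P L * flowMoment Γ P (L * q + s) := flowMoment_add_le Γ P _ _
        _ ≤ (1 / 4) * ((1 / 4) ^ q * flowMoment Γ P s) :=
            mul_le_mul hL ih (flowMoment_nonneg Γ P _) (by norm_num)
        _ = (1 / 4) ^ (q + 1) * flowMoment Γ P s := by ring
  set C₀ := ∑ s ∈ Finset.range L, flowMoment Γ P s
  have hC₀ : 0 ≤ C₀ := Finset.sum_nonneg fun s _ => flowMoment_nonneg Γ P s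
  -- Then `r ^ (2 * L) = 1 / 4`, the decay over one block of length `L`. Bounding by a square lets
  -- its root bound first moments.
  set r : ℝ := (1 / 2) ^ (1 / L : ℝ) with hr
  have hr0 : 0 < r := by positivity
  have hr1 : r < 1 := Real.rpow_lt_one (by norm_num) (by norm_num) (by positivity)
  have hrL : r ^ L = 1 / 2 := by
    rw [hr, ← Real.rpow_natCast, ← Real.rpow_mul (by norm_num)]
    rw [one_div_mul_cancel (by positivity), Real.rpow_one]
  refine ⟨2 * Real.sqrt C₀, r, by positivity, hr0.le, hr1, fun k => ?_⟩
  have hk : L * (k / L) + k % L = k := Nat.div_add_mod k L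
  have hmod : k % L < L := Nat.mod_lt k hL1
  have hs : flowMoment Γ P (k % L) ≤ C₀ :=
    Finset.single_le_sum (f := flowMoment Γ P) (fun s _ => flowMoment_nonneg Γ P s)
      (Finset.mem_range.2 hmod)
  -- The incomplete last block costs at most a factor 2, because `r ^ (k % L) ≥ r ^ L = 1 / 2`.
  have hpow : (1 / 2 : ℝ) ^ (k / L) ≤ 2 * r ^ k := by
    have h1 : r ^ k = (1 / 2) ^ (k / L) * r ^ (k % L) := by
      conv_lhs => rw [← hk, pow_add, pow_mul, hrL]
    have h2 : 1 / 2 ≤ r ^ (k % L) := by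
      rw [← hrL]
      exact pow_le_pow_of_le_one hr0.le hr1.le hmod.le
    rw [h1]
    have h3 : (0 : ℝ) ≤ (1 / 2) ^ (k / L) := by positivity
    nlinarith
  calc flowMoment Γ P k = flowMoment Γ P (L * (k / L) + k % L) := by rw [hk]
    _ ≤ (1 / 4) ^ (k / L) * flowMoment Γ P (k % L) := hq _ _
    _ ≤ (1 / 4) ^ (k / L) * C₀ := by gcongr
    _ = ((1 / 2) ^ (k / L)) ^ 2 * C₀ := by
        rw [← pow_mul, mul_comm (k / L) 2, pow_mul]; norm_num
    _ ≤ (2 * r ^ k) ^ 2 * C₀ := by gcongr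
    _ = (2 * Real.sqrt C₀ * r ^ k) ^ 2 := by
        rw [mul_pow, mul_pow, mul_pow, Real.sq_sqrt hC₀]; ring

theorem integral_norm_linFlow_le {b : ℝ} (hb : 0 ≤ b) {k : ℕ}
    (h : flowMoment Γ P k ≤ b ^ 2) (i : Fin ν) :
    ∫ ω, ‖linFlow Γ ω k‖ ∂(chainLaw P i) ≤ b := by
  set m := ∫ ω, ‖linFlow Γ ω k‖ ∂(chainLaw P i) with hm
  have h1 := integrable_linFlow Γ P (fun A _ => ‖A‖ ^ 2) k i
  have h2 := integrable_linFlow Γ P (fun A _ => ‖A‖) k i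
  -- The variance is nonnegative, so the squared first moment is at most the second moment.
  have h0 : 0 ≤ ∫ ω, (‖linFlow Γ ω k‖ ^ 2 - 2 * m * ‖linFlow Γ ω k‖ + m ^ 2)
      ∂(chainLaw P i) := integral_nonneg fun ω => by
    have := sq_nonneg (‖linFlow Γ ω k‖ - m)
    simp only [Pi.zero_apply]
    linarith
  have h3 : Integrable (fun ω => ‖linFlow Γ ω k‖ ^ 2 - 2 * m * ‖linFlow Γ ω k‖)
    (chainLaw P i) := h1.sub (h2.const_mul _)
  rw [integral_add h3 (integrable_const _),
    integral_sub h1 (h2.const_mul _), integral_const_mul, ← hm] at h0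
  simp only [integral_const, probReal_univ, one_smul] at h0
  have := integral_le_flowMoment Γ P k i
  exact le_of_sq_le_sq (by nlinarith) hb

end Linear

/-! ### Solving the coupled Lyapunov equations by series. -/

section LyapunovEquation

variable {n ν : ℕ} (P : Matrix.rowStochastic ℝ (Fin ν)) (Γ : Fin ν → (Vec n →L[ℝ] Vec n))
  (w : Fin ν → ℝ) (q : Fin ν → Vec n)

/-- The quadratic form `𝔼[w(θ_k) ‖x_k‖²]` along `x_{k+1} = Γ_{θ_k} x_k`, as an operator. -/
noncomputable def stageOp (i : Fin ν) (k : ℕ) : Vec n →L[ℝ] Vec n :=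
  ∫ ω, w (ω k) • (ContinuousLinearMap.adjoint (linFlow Γ ω k)).comp (linFlow Γ ω k)
    ∂(chainLaw P i)

/-- The linear form `𝔼⟪q(θ_k), x_k⟫` along `x_{k+1} = Γ_{θ_k} x_k`, as a vector. -/
noncomputable def stageVec (i : Fin ν) (k : ℕ) : Vec n :=
  ∫ ω, ContinuousLinearMap.adjoint (linFlow Γ ω k) (q (ω k)) ∂(chainLaw P i)

/-- Bounded functionals commute with the Bochner integral. All operator identities below are checked
in this weak form. -/
theorem inner_stageOp (i : Fin ν) (k : ℕ) (x y : Vec n) :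
    inner ℝ y (stageOp P Γ w i k x) =
      ∫ ω, w (ω k) * inner ℝ (linFlow Γ ω k y) (linFlow Γ ω k x) ∂(chainLaw P i) := by
  have h := ((innerSL ℝ y).comp (ContinuousLinearMap.apply ℝ (Vec n) x)).integral_comp_comm
    (integrable_linFlow Γ P (fun A j => w j • (ContinuousLinearMap.adjoint A).comp A) k i)
  simp only [ContinuousLinearMap.comp_apply, ContinuousLinearMap.apply_apply,
    innerSL_apply_apply, smul_apply, inner_smul_right,
    ContinuousLinearMap.adjoint_inner_right] at h
  exact h.symm

theorem inner_stageVec (i : Fin ν) (k : ℕ) (x : Vec n) :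
    inner ℝ (stageVec P Γ q i k) x =
      ∫ ω, inner ℝ (q (ω k)) (linFlow Γ ω k x) ∂(chainLaw P i) := by
  have h := (innerSL ℝ x).integral_comp_comm
    (integrable_linFlow Γ P (fun A j => ContinuousLinearMap.adjoint A (q j)) k i)
  simp only [innerSL_apply_apply, ContinuousLinearMap.adjoint_inner_right] at h
  rw [real_inner_comm, stageVec, ← h]
  exact integral_congr_ae (Eventually.of_forall fun ω => real_inner_comm _ _)

theorem inner_stageOp_zero (i : Fin ν) (x y : Vec n) :
    inner ℝ y (stageOp P Γ w i 0 x) = w i * inner ℝ y x := by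
  rw [inner_stageOp]
  exact integral_mode_zero P i fun ω hω => by simp [linFlow, hω]

theorem inner_stageOp_succ (i : Fin ν) (k : ℕ) (x y : Vec n) :
    inner ℝ y (stageOp P Γ w i (k + 1) x) =
      ∑ j, P.1 i j * inner ℝ (Γ i y) (stageOp P Γ w j k (Γ i x)) := by
  simp only [inner_stageOp]
  rw [integral_chainLaw (dependsOn_linFlow_mode Γ (fun A j => w j * inner ℝ (A y) (A x)) (k + 1))]
  simp only [linFlow_consPath, consPath_succ, smul_eq_mul, ContinuousLinearMap.comp_apply]

theorem inner_stageVec_zero (i : Fin ν) (x : Vec n) :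
    inner ℝ (stageVec P Γ q i 0) x = inner ℝ (q i) x := by
  rw [inner_stageVec]
  exact integral_mode_zero P i fun ω hω => by simp [linFlow, hω]

theorem inner_stageVec_succ (i : Fin ν) (k : ℕ) (x : Vec n) :
    inner ℝ (stageVec P Γ q i (k + 1)) x =
      ∑ j, P.1 i j * inner ℝ (stageVec P Γ q j k) (Γ i x) := by
  simp only [inner_stageVec]
  rw [integral_chainLaw (dependsOn_linFlow_mode Γ (fun A j => inner ℝ (q j) (A x)) (k + 1))]
  simp only [linFlow_consPath, consPath_succ, smul_eq_mul, ContinuousLinearMap.comp_apply]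

theorem norm_stageOp_le (i : Fin ν) (k : ℕ) :
    ‖stageOp P Γ w i k‖ ≤ (∑ j, |w j|) * flowMoment Γ P k := by
  calc ‖stageOp P Γ w i k‖
      ≤ ∫ ω, ‖w (ω k) • (ContinuousLinearMap.adjoint (linFlow Γ ω k)).comp (linFlow Γ ω k)‖
        ∂(chainLaw P i) := norm_integral_le_integral_norm _
    _ ≤ ∫ ω, (∑ j, |w j|) * ‖linFlow Γ ω k‖ ^ 2 ∂(chainLaw P i) := by
        refine integral_mono (integrable_linFlow Γ P
          (fun A j => w j • (ContinuousLinearMap.adjoint A).comp A) k i).norm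
          (integrable_linFlow Γ P (fun A _ => (∑ j, |w j|) * ‖A‖ ^ 2) k i) fun ω => ?_
        simp only [norm_smul, Real.norm_eq_abs]
        gcongr
        · exact Finset.single_le_sum (f := fun j => |w j|) (fun j _ => abs_nonneg _)
            (Finset.mem_univ _)
        · refine (ContinuousLinearMap.opNorm_comp_le _ _).trans_eq ?_
          rw [LinearIsometryEquiv.norm_map, sq]
    _ ≤ (∑ j, |w j|) * flowMoment Γ P k := by
        rw [integral_const_mul]
        gcongr
        exact integral_le_flowMoment Γ P k i

theorem norm_stageVec_le {b : ℝ} (hb : 0 ≤ b) {k : ℕ} (h : flowMoment Γ P k ≤ b ^ 2)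
    (i : Fin ν) : ‖stageVec P Γ q i k‖ ≤ (∑ j, ‖q j‖) * b := by
  calc ‖stageVec P Γ q i k‖
      ≤ ∫ ω, ‖ContinuousLinearMap.adjoint (linFlow Γ ω k) (q (ω k))‖ ∂(chainLaw P i) :=
        norm_integral_le_integral_norm _
    _ ≤ ∫ ω, (∑ j, ‖q j‖) * ‖linFlow Γ ω k‖ ∂(chainLaw P i) := by
        refine integral_mono (integrable_linFlow Γ P
          (fun A j => ContinuousLinearMap.adjoint A (q j)) k i).norm
          (integrable_linFlow Γ P (fun A _ => (∑ j, ‖q j‖) * ‖A‖) k i) fun ω => ?_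
        refine (ContinuousLinearMap.le_opNorm _ _).trans ?_
        rw [LinearIsometryEquiv.norm_map, mul_comm]
        gcongr
        exact Finset.single_le_sum (f := fun j => ‖q j‖) (fun j _ => norm_nonneg _)
          (Finset.mem_univ _)
    _ ≤ (∑ j, ‖q j‖) * b := by
        rw [integral_const_mul]
        gcongr
        exact integral_norm_linFlow_le Γ P hb h i

variable {P Γ}

theorem summable_flowMoment (h : IsMSStable P (fun z i => Γ i z)) :
    Summable (flowMoment Γ P) := by
  obtain ⟨C, r, hC, hr0, hr1, hle⟩ := exists_flowMoment_le Γ P h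
  refine Summable.of_nonneg_of_le (flowMoment_nonneg Γ P) hle ?_
  have : Summable fun k : ℕ => C ^ 2 * (r ^ 2) ^ k :=
    (summable_geometric_of_lt_one (by positivity) (by nlinarith)).mul_left _
  refine this.congr fun k => ?_
  ring

theorem summable_stageOp (h : IsMSStable P (fun z i => Γ i z)) (i : Fin ν) :
    Summable (stageOp P Γ w i) :=
  Summable.of_norm_bounded ((summable_flowMoment h).mul_left _) (norm_stageOp_le P Γ w i)

/-- These terms are of first order in the flow, so summable second moments alone would not do; the
geometric rate is needed. -/
theorem summable_stageVec (h : IsMSStable P (fun z i => Γ i z)) (i : Fin ν) :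
    Summable (stageVec P Γ q i) := by
  obtain ⟨C, r, hC, hr0, hr1, hle⟩ := exists_flowMoment_le Γ P h
  refine Summable.of_norm_bounded
    (((summable_geometric_of_lt_one hr0 hr1).mul_left C).mul_left (∑ j, ‖q j‖)) fun k => ?_
  exact norm_stageVec_le P Γ q (by positivity) (hle k) i

variable (P Γ)

/-- The solution `P_i = ∑_k 𝔼[w(θ_k) Φ_kᵀ Φ_k]` of the coupled Lyapunov equations. -/
noncomputable def lyapOp (i : Fin ν) : Vec n →L[ℝ] Vec n := ∑' k, stageOp P Γ w i k

/-- The solution `p_i = ∑_k 𝔼[Φ_kᵀ q(θ_k)]` of the coupled linear equations. -/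
noncomputable def lyapVec (i : Fin ν) : Vec n := ∑' k, stageVec P Γ q i k

variable {P Γ}

theorem hasSum_inner_stageOp (h : IsMSStable P (fun z i => Γ i z)) (i : Fin ν) (x y : Vec n) :
    HasSum (fun k => inner ℝ y (stageOp P Γ w i k x)) (inner ℝ y (lyapOp P Γ w i x)) :=
  (summable_stageOp w h i).hasSum.mapL
    ((innerSL ℝ y).comp (ContinuousLinearMap.apply ℝ (Vec n) x))

theorem hasSum_inner_stageVec (h : IsMSStable P (fun z i => Γ i z)) (i : Fin ν) (x : Vec n) :
    HasSum (fun k => inner ℝ (stageVec P Γ q i k) x) (inner ℝ (lyapVec P Γ q i) x) := by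
  have := (summable_stageVec q h i).hasSum.mapL (innerSL ℝ x)
  have hcomm : ∀ v, inner ℝ v x = inner ℝ x v := fun v => real_inner_comm x v
  simp only [hcomm]
  exact this

theorem isPositive_lyapOp (hw : ∀ i, 0 ≤ w i) (h : IsMSStable P (fun z i => Γ i z)) (i : Fin ν) :
    (lyapOp P Γ w i).IsPositive := by
  refine ⟨fun x y => ?_, fun x => ?_⟩
  · have h1 := hasSum_inner_stageOp w h i x y
    have h2 := hasSum_inner_stageOp w h i y x
    have h3 : ∀ k, inner ℝ y (stageOp P Γ w i k x) = inner ℝ x (stageOp P Γ w i k y) := by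
      intro k
      simp only [inner_stageOp]
      exact integral_congr_ae (Eventually.of_forall fun ω => by
        simp only [real_inner_comm])
    simp only [h3] at h1
    change inner ℝ (lyapOp P Γ w i x) y = inner ℝ x (lyapOp P Γ w i y)
    rw [real_inner_comm]
    exact h1.unique h2
  · rw [ContinuousLinearMap.reApplyInnerSelf_apply, real_inner_comm]
    refine (hasSum_inner_stageOp w h i x x).nonneg fun k => ?_
    rw [inner_stageOp]
    exact integral_nonneg fun ω => mul_nonneg (hw _) real_inner_self_nonneg

/-- The term `k = 0` gives the weight; by `inner_stageOp_succ` the rest is the average of the same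
series after one transition. -/
theorem inner_lyapOp (h : IsMSStable P (fun z i => Γ i z)) (i : Fin ν) (x y : Vec n) :
    inner ℝ y (lyapOp P Γ w i x) =
      w i * inner ℝ y x + ∑ j, P.1 i j * inner ℝ (Γ i y) (lyapOp P Γ w j (Γ i x)) := by
  have h1 : HasSum (fun k => inner ℝ y (stageOp P Γ w i (k + 1) x))
      (∑ j, P.1 i j * inner ℝ (Γ i y) (lyapOp P Γ w j (Γ i x))) := by
    simp only [inner_stageOp_succ]
    exact hasSum_sum fun j _ => (hasSum_inner_stageOp w h j _ _).mul_left _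
  have h2 := (hasSum_nat_add_iff (f := fun k => inner ℝ y (stageOp P Γ w i k x)) 1).1 h1
  rw [(hasSum_inner_stageOp w h i x y).unique h2]
  simp [inner_stageOp_zero, add_comm]

theorem inner_lyapVec (h : IsMSStable P (fun z i => Γ i z)) (i : Fin ν) (x : Vec n) :
    inner ℝ (lyapVec P Γ q i) x =
      inner ℝ (q i) x + ∑ j, P.1 i j * inner ℝ (lyapVec P Γ q j) (Γ i x) := by
  have h1 : HasSum (fun k => inner ℝ (stageVec P Γ q i (k + 1)) x)
      (∑ j, P.1 i j * inner ℝ (lyapVec P Γ q j) (Γ i x)) := by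
    simp only [inner_stageVec_succ]
    exact hasSum_sum fun j _ => (hasSum_inner_stageVec q h j _).mul_left _
  have h2 := (hasSum_nat_add_iff (f := fun k => inner ℝ (stageVec P Γ q i k) x) 1).1 h1
  rw [(hasSum_inner_stageVec q h i x).unique h2]
  simp [inner_stageVec_zero, add_comm]

theorem lyapOp_eq (h : IsMSStable P (fun z i => Γ i z)) (i : Fin ν) :
    lyapOp P Γ w i = w i • ContinuousLinearMap.id ℝ (Vec n) +
      (ContinuousLinearMap.adjoint (Γ i)).comp ((modeAvg P (lyapOp P Γ w) i).comp (Γ i)) := by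
  ext1 x
  refine ext_inner_left ℝ fun y => ?_
  rw [inner_lyapOp w h]
  simp [modeAvg, inner_add_right, inner_smul_right, ContinuousLinearMap.adjoint_inner_right,
    inner_sum]

theorem lyapVec_eq (h : IsMSStable P (fun z i => Γ i z)) (i : Fin ν) :
    lyapVec P Γ q i = q i + ContinuousLinearMap.adjoint (Γ i) (modeAvg P (lyapVec P Γ q) i) := by
  refine ext_inner_right ℝ fun x => ?_
  rw [inner_lyapVec q h]
  simp [modeAvg, inner_add_left, inner_smul_left, ContinuousLinearMap.adjoint_inner_left,
    sum_inner]

end LyapunovEquation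

/-! ### Two analytic tools: almost sure summation and a Taylor estimate. -/

/-- If the `L¹` norms are summable, then the series converges almost surely, to an integrable
limit. -/
theorem ae_summable_and_integrable_tsum {Ω : Type*} [MeasurableSpace Ω] {μ : Measure Ω}
    {F : ℕ → Ω → ℝ} (hF : ∀ k, Integrable (F k) μ) (hs : Summable fun k => ∫ ω, ‖F k ω‖ ∂μ) :
    (∀ᵐ ω ∂μ, Summable fun k => F k ω) ∧ Integrable (fun ω => ∑' k, F k ω) μ := by
  have hm : ∀ k, AEMeasurable (fun ω => ‖F k ω‖ₑ) μ := fun k => (hF k).1.enorm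
  have hlt : ∫⁻ ω, ∑' k, ‖F k ω‖ₑ ∂μ < ∞ := by
    rw [lintegral_tsum hm]
    have h1 : ∀ k, ∫⁻ ω, ‖F k ω‖ₑ ∂μ = ENNReal.ofReal (∫ ω, ‖F k ω‖ ∂μ) := fun k =>
      (ofReal_integral_norm_eq_lintegral_enorm (hF k)).symm
    simp only [h1]
    rw [← ENNReal.ofReal_tsum_of_nonneg (fun k => integral_nonneg fun ω => norm_nonneg _) hs]
    exact ENNReal.ofReal_lt_top
  have hfin := ae_lt_top' (AEMeasurable.tsum hm) hlt.ne
  have hsum : ∀ᵐ ω ∂μ, Summable fun k => F k ω := by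
    filter_upwards [hfin] with ω hω
    refine Summable.of_norm ?_
    exact (ENNReal.summable_toReal hω.ne).congr fun k => by simp
  refine ⟨hsum, ⟨?_, ?_⟩⟩
  · refine aestronglyMeasurable_of_tendsto_ae atTop
      (f := fun T ω => ∑ k ∈ Finset.range T, F k ω) (fun T => ?_) ?_
    · exact (integrable_finsetSum _ fun k _ => hF k).1
    · filter_upwards [hsum] with ω hω
      exact hω.hasSum.tendsto_sum_nat
  · refine lt_of_le_of_lt (lintegral_mono fun ω => ?_) hlt
    exact enorm_tsum_le_tsum_enorm

/-- First-order Taylor estimate for functions with Lipschitz derivative. -/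
theorem BetaSmooth.norm_sub_sub_le {n : ℕ} {G : Type*} [NormedAddCommGroup G] [NormedSpace ℝ G]
    {β : ℝ≥0} {g : Vec n → G} (hg : BetaSmooth β g) (x : Vec n) :
    ‖g x - g 0 - fderiv ℝ g 0 x‖ ≤ β * ‖x‖ ^ 2 := by
  -- On the ball of radius `‖x‖` the derivative varies from its value at 0 by at most `β * ‖x‖`. The
  -- mean value inequality loses the factor 1/2 of the sharp estimate, which a larger `α₀` absorbs.
  have h := (convex_closedBall (0 : Vec n) ‖x‖).norm_image_sub_le_of_norm_fderiv_le'
    (f := g) (φ := fderiv ℝ g 0) (C := β * ‖x‖) (x := 0) (y := x) (fun y _ => hg.1 y)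
    (fun y hy => ?_) (by simp) (by simp)
  · simpa [sq, mul_assoc] using h
  · have h1 := hg.2.norm_sub_le y 0
    refine h1.trans ?_
    have : ‖y - 0‖ ≤ ‖x‖ := by simpa using hy
    gcongr

/-! ### Drift of the quadratic and linear forms under an O(‖x‖²) perturbation. -/

section Drift

variable {n ν : ℕ} {P : Matrix.rowStochastic ℝ (Fin ν)} {Γ : Fin ν → (Vec n →L[ℝ] Vec n)}

/-- One-step change of the quadratic Lyapunov function along a perturbation of the linear
system. -/
theorem exists_quadratic_drift_le (h : IsMSStable P (fun z i => Γ i z)) {w : Fin ν → ℝ}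
    (hw : ∀ i, 0 ≤ w i) {F : Vec n → Fin ν → Vec n} {b : ℝ} (hb : 0 ≤ b)
    (hF : ∀ x i, ‖F x i - Γ i x‖ ≤ b * ‖x‖ ^ 2) :
    ∃ c : ℝ, 0 ≤ c ∧ ∀ i x, ‖x‖ ≤ 1 →
      ∑ j, P.1 i j * inner ℝ (F x i) (lyapOp P Γ w j (F x i)) ≤
        inner ℝ x (lyapOp P Γ w i x) - w i * ‖x‖ ^ 2 + c * ‖x‖ * ‖x‖ ^ 2 := by
  set M := ∑ j, ‖lyapOp P Γ w j‖ with hM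
  set g := ∑ j, ‖Γ j‖ with hg
  have hM0 : 0 ≤ M := Finset.sum_nonneg fun j _ => norm_nonneg _
  have hg0 : 0 ≤ g := Finset.sum_nonneg fun j _ => norm_nonneg _
  -- The two cross terms contribute `2 * b * g` at order ‖x‖³. The term quadratic in the remainder
  -- has order ‖x‖⁴ and is lowered to ‖x‖³ on the unit ball.
  refine ⟨M * (2 * b * g + b ^ 2), by positivity, fun i x hx => ?_⟩
  set r := F x i - Γ i x with hr
  have hFr : F x i = Γ i x + r := by rw [hr]; abel
  have hrle : ‖r‖ ≤ b * ‖x‖ ^ 2 := hF x i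
  have hΓ : ‖Γ i x‖ ≤ g * ‖x‖ := by
    refine ((Γ i).le_opNorm x).trans ?_
    gcongr
    exact Finset.single_le_sum (f := fun j => ‖Γ j‖) (fun j _ => norm_nonneg _)
      (Finset.mem_univ i)
  have hbil : ∀ j (u v : Vec n), inner ℝ u (lyapOp P Γ w j v) ≤ M * (‖u‖ * ‖v‖) := by
    intro j u v
    calc inner ℝ u (lyapOp P Γ w j v) ≤ ‖u‖ * ‖lyapOp P Γ w j v‖ := real_inner_le_norm _ _
      _ ≤ ‖u‖ * (M * ‖v‖) := by
        gcongr
        refine ((lyapOp P Γ w j).le_opNorm v).trans ?_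
        gcongr
        exact Finset.single_le_sum (f := fun j => ‖lyapOp P Γ w j‖) (fun j _ => norm_nonneg _)
          (Finset.mem_univ j)
      _ = M * (‖u‖ * ‖v‖) := by ring
  have hterm : ∀ j, inner ℝ (F x i) (lyapOp P Γ w j (F x i)) ≤
      inner ℝ (Γ i x) (lyapOp P Γ w j (Γ i x)) + M * (2 * b * g + b ^ 2) * ‖x‖ * ‖x‖ ^ 2 := by
    intro j
    have hsym : inner ℝ (Γ i x) (lyapOp P Γ w j r) = inner ℝ r (lyapOp P Γ w j (Γ i x)) := by
      have := (isPositive_lyapOp w hw h j).isSymmetric (Γ i x) r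
      rw [real_inner_comm] at this
      exact this.symm
    rw [hFr, map_add, inner_add_left, inner_add_right, inner_add_right, hsym]
    have h1 : inner ℝ r (lyapOp P Γ w j (Γ i x)) ≤ M * (b * ‖x‖ ^ 2 * (g * ‖x‖)) :=
      (hbil j _ _).trans (by gcongr)
    have h2 : inner ℝ r (lyapOp P Γ w j r) ≤ M * (b * ‖x‖ ^ 2 * (b * ‖x‖ ^ 2)) :=
      (hbil j _ _).trans (by gcongr)
    have h3 : M * (b * ‖x‖ ^ 2 * (b * ‖x‖ ^ 2)) ≤ M * b ^ 2 * ‖x‖ * ‖x‖ ^ 2 := by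
      calc M * (b * ‖x‖ ^ 2 * (b * ‖x‖ ^ 2)) = M * b ^ 2 * ‖x‖ * ‖x‖ ^ 2 * ‖x‖ := by ring
        _ ≤ M * b ^ 2 * ‖x‖ * ‖x‖ ^ 2 * 1 := by gcongr
        _ = _ := mul_one _
    nlinarith
  rw [inner_lyapOp w h i x x, real_inner_self_eq_norm_sq]
  calc ∑ j, P.1 i j * inner ℝ (F x i) (lyapOp P Γ w j (F x i))
      ≤ ∑ j, P.1 i j * (inner ℝ (Γ i x) (lyapOp P Γ w j (Γ i x)) +
          M * (2 * b * g + b ^ 2) * ‖x‖ * ‖x‖ ^ 2) :=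
        Finset.sum_le_sum fun j _ =>
          mul_le_mul_of_nonneg_left (hterm j) (transition_nonneg P i j)
    _ = _ := by
        simp only [mul_add (P.1 i _), Finset.sum_add_distrib, ← Finset.sum_mul, transition_sum]
        ring

/-- One-step change of the linear part of the terminal cost along a perturbation of the linear
system. -/
theorem exists_linear_drift_le (h : IsMSStable P (fun z i => Γ i z)) (q : Fin ν → Vec n)
    {F : Vec n → Fin ν → Vec n} {b : ℝ} (hb : 0 ≤ b)
    (hF : ∀ x i, ‖F x i - Γ i x‖ ≤ b * ‖x‖ ^ 2) :
    ∃ c : ℝ, 0 ≤ c ∧ ∀ i x,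
      ∑ j, P.1 i j * inner ℝ (lyapVec P Γ q j) (F x i) ≤
        inner ℝ (lyapVec P Γ q i) x - inner ℝ (q i) x + c * ‖x‖ ^ 2 := by
  set M := ∑ j, ‖lyapVec P Γ q j‖ with hM
  have hM0 : 0 ≤ M := Finset.sum_nonneg fun j _ => norm_nonneg _
  -- Here the error is only quadratic: shrinking the ball does not make it small relative to ‖x‖²,
  -- so it must be absorbed by `α`.
  refine ⟨M * b, by positivity, fun i x => ?_⟩
  have hterm : ∀ j, inner ℝ (lyapVec P Γ q j) (F x i) ≤
      inner ℝ (lyapVec P Γ q j) (Γ i x) + M * b * ‖x‖ ^ 2 := by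
    intro j
    have h1 : inner ℝ (lyapVec P Γ q j) (F x i - Γ i x) ≤ M * (b * ‖x‖ ^ 2) := by
      refine (real_inner_le_norm _ _).trans ?_
      gcongr
      · exact Finset.single_le_sum (f := fun j => ‖lyapVec P Γ q j‖) (fun j _ => norm_nonneg _)
          (Finset.mem_univ j)
      · exact hF x i
    rw [inner_sub_right] at h1
    linarith
  rw [inner_lyapVec q h i x]
  calc ∑ j, P.1 i j * inner ℝ (lyapVec P Γ q j) (F x i)
      ≤ ∑ j, P.1 i j * (inner ℝ (lyapVec P Γ q j) (Γ i x) + M * b * ‖x‖ ^ 2) :=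
        Finset.sum_le_sum fun j _ =>
          mul_le_mul_of_nonneg_left (hterm j) (transition_nonneg P i j)
    _ = _ := by
        simp only [mul_add (P.1 i _), Finset.sum_add_distrib, ← Finset.sum_mul, transition_sum]
        ring

end Drift

/-! ### The terminal cost and its decrease near the origin. -/

namespace Plant

variable {n m ν : ℕ} (S : Plant n m ν) {K : Fin ν → (Vec n →L[ℝ] Vec m)}

theorem costTerm_eq (β : Fin ν → ℝ≥0) (α : ℝ) (x : Vec n) (ω : ModePath ν) (k : ℕ) :
    S.costTerm K β α x ω k =
      1 / 2 * ((α + β (ω k)) * ‖linFlow (S.Gamma K) ω k x‖ ^ 2) +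
        inner ℝ (S.q K (ω k)) (linFlow (S.Gamma K) ω k x) := by
  rw [costTerm, ellQ, flow_eq_linFlow, inner_smul_right, real_inner_self_eq_norm_sq]

theorem integrable_costTerm (β : Fin ν → ℝ≥0) (α : ℝ) (x : Vec n) (i : Fin ν) (k : ℕ) :
    Integrable (fun ω => S.costTerm K β α x ω k) (chainLaw S.P i) :=
  integrable_of_dependsOn (dependsOn_flow_mode _ x (S.ellQ K β α) k) _

theorem integral_costTerm (β : Fin ν → ℝ≥0) (α : ℝ) (x : Vec n) (i : Fin ν) (k : ℕ) :
    ∫ ω, S.costTerm K β α x ω k ∂(chainLaw S.P i) =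
      1 / 2 * (inner ℝ x (stageOp S.P (S.Gamma K) (fun j => β j) i k x) +
        α * inner ℝ x (stageOp S.P (S.Gamma K) (fun _ => 1) i k x)) +
        inner ℝ (stageVec S.P (S.Gamma K) (S.q K) i k) x := by
  have hβ : Integrable (fun ω => (β (ω k) : ℝ) * ‖linFlow (S.Gamma K) ω k x‖ ^ 2)
      (chainLaw S.P i) := integrable_linFlow _ _ (fun A j => (β j : ℝ) * ‖A x‖ ^ 2) k i
  have h1 : Integrable (fun ω => (1 : ℝ) * ‖linFlow (S.Gamma K) ω k x‖ ^ 2)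
      (chainLaw S.P i) := integrable_linFlow _ _ (fun A _ => (1 : ℝ) * ‖A x‖ ^ 2) k i
  have hq : Integrable (fun ω => inner ℝ (S.q K (ω k)) (linFlow (S.Gamma K) ω k x))
      (chainLaw S.P i) := integrable_linFlow _ _ (fun A j => inner ℝ (S.q K j) (A x)) k i
  have hquad : Integrable (fun ω => 1 / 2 *
      ((β (ω k) : ℝ) * ‖linFlow (S.Gamma K) ω k x‖ ^ 2 +
        α * (1 * ‖linFlow (S.Gamma K) ω k x‖ ^ 2))) (chainLaw S.P i) :=
    (hβ.add (h1.const_mul α)).const_mul _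
  simp only [inner_stageOp, inner_stageVec, real_inner_self_eq_norm_sq]
  rw [← integral_const_mul, ← integral_add hβ (h1.const_mul α), ← integral_const_mul,
    ← integral_add hquad hq]
  refine integral_congr_ae (Eventually.of_forall fun ω => ?_)
  simp only [costTerm_eq]
  ring

/-- The quadratic part is controlled by second moments, the linear part by the geometric bound on
first moments. This licenses interchanging expectation and series in `Vf`. -/
theorem summable_integral_norm_costTerm (hK : S.IsMSStabilizing K) (β : Fin ν → ℝ≥0) {α : ℝ}
    (hα : 0 ≤ α) (x : Vec n) (i : Fin ν) :
    Summable fun k => ∫ ω, ‖S.costTerm K β α x ω k‖ ∂(chainLaw S.P i) := by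
  obtain ⟨C, r, hC, hr0, hr1, hle⟩ := exists_flowMoment_le (S.Gamma K) S.P hK
  set B : ℝ := ∑ j, (β j : ℝ)
  set Q : ℝ := ∑ j, ‖S.q K j‖
  have hB : 0 ≤ B := Finset.sum_nonneg fun j _ => (β j).2
  have hQ : 0 ≤ Q := Finset.sum_nonneg fun j _ => norm_nonneg _
  have hsum : Summable fun k => (1 / 2 * ((α + B) * ‖x‖ ^ 2)) * flowMoment (S.Gamma K) S.P k +
      (Q * ‖x‖) * (C * r ^ k) :=
    ((summable_flowMoment hK).mul_left _).add
      (((summable_geometric_of_lt_one hr0 hr1).mul_left C).mul_left _)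
  refine Summable.of_nonneg_of_le (fun k => integral_nonneg fun ω => norm_nonneg _)
    (fun k => ?_) hsum
  have h2 := integrable_linFlow (S.Gamma K) S.P (fun A _ => ‖A‖ ^ 2) k i
  have h1 := integrable_linFlow (S.Gamma K) S.P (fun A _ => ‖A‖) k i
  calc ∫ ω, ‖S.costTerm K β α x ω k‖ ∂(chainLaw S.P i)
      ≤ ∫ ω, ((1 / 2 * ((α + B) * ‖x‖ ^ 2)) * ‖linFlow (S.Gamma K) ω k‖ ^ 2 +
          (Q * ‖x‖) * ‖linFlow (S.Gamma K) ω k‖) ∂(chainLaw S.P i) := by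
        refine integral_mono (S.integrable_costTerm β α x i k).norm
          ((h2.const_mul _).add (h1.const_mul _)) fun ω => ?_
        have hL := (linFlow (S.Gamma K) ω k).le_opNorm x
        have hβ : (β (ω k) : ℝ) ≤ B := Finset.single_le_sum (f := fun j => (β j : ℝ))
          (fun j _ => (β j).2) (Finset.mem_univ _)
        have hq : ‖S.q K (ω k)‖ ≤ Q := Finset.single_le_sum (f := fun j => ‖S.q K j‖)
          (fun j _ => norm_nonneg _) (Finset.mem_univ _)
        simp only [costTerm_eq]
        refine (norm_add_le _ _).trans ?_
        have hβ0 : 0 ≤ (β (ω k) : ℝ) := (β (ω k)).2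
        have e1 : ‖1 / 2 * ((α + β (ω k)) * ‖linFlow (S.Gamma K) ω k x‖ ^ 2)‖ ≤
            1 / 2 * ((α + B) * (‖linFlow (S.Gamma K) ω k‖ * ‖x‖) ^ 2) := by
          rw [Real.norm_of_nonneg (by positivity)]
          gcongr
        have e2 : ‖(inner ℝ (S.q K (ω k)) (linFlow (S.Gamma K) ω k x) : ℝ)‖ ≤
            Q * (‖linFlow (S.Gamma K) ω k‖ * ‖x‖) :=
          (norm_inner_le_norm _ _).trans (by gcongr)
        refine (add_le_add e1 e2).trans_eq ?_
        ring
    _ ≤ _ := by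
        rw [integral_add (h2.const_mul _) (h1.const_mul _), integral_const_mul,
          integral_const_mul]
        gcongr
        · exact integral_le_flowMoment _ _ k i
        · exact integral_norm_linFlow_le _ _ (by positivity) (hle k) i

theorem Vf_eq (hK : S.IsMSStabilizing K) (β : Fin ν → ℝ≥0) {α : ℝ} (hα : 0 ≤ α) (x : Vec n)
    (i : Fin ν) :
    S.Vf K β α x i =
      1 / 2 * (inner ℝ x (lyapOp S.P (S.Gamma K) (fun j => β j) i x) +
        α * inner ℝ x (lyapOp S.P (S.Gamma K) (fun _ => 1) i x)) +
        inner ℝ (lyapVec S.P (S.Gamma K) (S.q K) i) x := by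
  have h1 := hasSum_integral_of_summable_integral_norm
    (fun k => S.integrable_costTerm (K := K) β α x i k)
    (S.summable_integral_norm_costTerm hK β hα x i)
  simp only [integral_costTerm] at h1
  refine h1.unique (HasSum.add (HasSum.mul_left _ (HasSum.add ?_ (HasSum.mul_left _ ?_))) ?_)
  · exact hasSum_inner_stageOp _ hK i x x
  · exact hasSum_inner_stageOp _ hK i x x
  · exact hasSum_inner_stageVec _ hK i x

/-- The derivative of the closed loop under the terminal law at the origin is `Γ_i`. -/
theorem hasFDerivAt_closedLoop
    (hdiff : ∀ i, DifferentiableAt ℝ (fun p : Vec n × Vec m => S.f p.1 p.2 i) 0) (i : Fin ν) :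
    HasFDerivAt (fun x => S.closedLoop (kappaF K) x i) (S.Gamma K i) 0 := by
  obtain ⟨D, hD⟩ := hdiff i
  have hA : HasFDerivAt (fun x : Vec n => S.f x 0 i)
      (D.comp (ContinuousLinearMap.inl ℝ (Vec n) (Vec m))) 0 :=
    HasFDerivAt.comp (g := fun p : Vec n × Vec m => S.f p.1 p.2 i) (f := fun x => (x, 0)) 0
      hD (ContinuousLinearMap.inl ℝ (Vec n) (Vec m)).hasFDerivAt
  have hB : HasFDerivAt (fun u : Vec m => S.f 0 u i)
      (D.comp (ContinuousLinearMap.inr ℝ (Vec n) (Vec m))) 0 :=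
    HasFDerivAt.comp (g := fun p : Vec n × Vec m => S.f p.1 p.2 i) (f := fun u => (0, u)) 0
      hD (ContinuousLinearMap.inr ℝ (Vec n) (Vec m)).hasFDerivAt
  have hC : HasFDerivAt (fun x : Vec n => S.f x (K i x) i)
      (D.comp ((ContinuousLinearMap.id ℝ (Vec n)).prod (K i))) 0 :=
    HasFDerivAt.comp (g := fun p : Vec n × Vec m => S.f p.1 p.2 i) (f := fun x => (x, K i x)) 0
      (by rw [map_zero]; exact hD) ((ContinuousLinearMap.id ℝ (Vec n)).prod (K i)).hasFDerivAt
  have hG : S.Gamma K i = D.comp ((ContinuousLinearMap.id ℝ (Vec n)).prod (K i)) := by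
    rw [Gamma, A, B, hA.fderiv, hB.fderiv]
    ext1 x
    simp [← map_add]
  rw [hG]
  exact hC

theorem norm_closedLoop_sub_le (heq : S.CommonEquilibrium)
    (hdiff : ∀ i, DifferentiableAt ℝ (fun p : Vec n × Vec m => S.f p.1 p.2 i) 0)
    {βf : Fin ν → ℝ≥0} (hf : ∀ i, BetaSmooth (βf i) (fun x => S.closedLoop (kappaF K) x i))
    (x : Vec n) (i : Fin ν) :
    ‖S.closedLoop (kappaF K) x i - S.Gamma K i x‖ ≤ (∑ j, (βf j : ℝ)) * ‖x‖ ^ 2 := by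
  have h := (hf i).norm_sub_sub_le x
  have h0 : S.closedLoop (kappaF K) 0 i = 0 := by
    simpa [closedLoop, kappaF] using (heq i).1.1
  rw [(S.hasFDerivAt_closedLoop hdiff i).fderiv, h0, sub_zero] at h
  refine h.trans ?_
  gcongr
  exact Finset.single_le_sum (f := fun j => (βf j : ℝ)) (fun j _ => (βf j).2) (Finset.mem_univ i)

theorem ellBar_le {βl : Fin ν → ℝ≥0} (hl : ∀ i, BetaSmooth (βl i) (fun x => S.ellBar K x i))
    (x : Vec n) (i : Fin ν) :
    S.ellBar K x i ≤ inner ℝ (S.q K i) x + βl i * ‖x‖ ^ 2 := by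
  have h := (le_abs_self _).trans ((hl i).norm_sub_sub_le x)
  have h0 : S.ellBar K 0 i = 0 := by simp [ellBar, kappaF]
  have hq : inner ℝ (S.q K i) x = fderiv ℝ (fun x => S.ellBar K x i) 0 x := by
    rw [q, gradient, InnerProductSpace.toDual_symm_apply]
  rw [h0] at h
  rw [hq]
  linarith

/-- On a small ball, for large `α`, the terminal cost decreases along the nonlinear closed loop,
and so does a positive definite quadratic form. -/
theorem exists_terminal_decrease (heq : S.CommonEquilibrium)
    (hdiff : ∀ i, DifferentiableAt ℝ (fun p : Vec n × Vec m => S.f p.1 p.2 i) 0)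
    {βf βl : Fin ν → ℝ≥0} (hf : ∀ i, BetaSmooth (βf i) (fun x => S.closedLoop (kappaF K) x i))
    (hl : ∀ i, BetaSmooth (βl i) (fun x => S.ellBar K x i)) (hK : S.IsMSStabilizing K) :
    ∃ δ : ℝ, 0 < δ ∧ ∃ α₀ : ℝ, 0 < α₀ ∧
      (∀ i, ∀ x ∈ Metric.ball (0 : Vec n) δ,
        ∑ j, S.P.1 i j * inner ℝ (S.closedLoop (kappaF K) x i)
          (lyapOp S.P (S.Gamma K) (fun _ => 1) j (S.closedLoop (kappaF K) x i)) ≤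
        inner ℝ x (lyapOp S.P (S.Gamma K) (fun _ => 1) i x) - 1 / 2 * ‖x‖ ^ 2) ∧
      ∀ α : ℝ, α₀ ≤ α → ∀ i, ∀ x ∈ Metric.ball (0 : Vec n) δ,
        generator S.P (S.closedLoop (kappaF K)) (S.Vf K βl α) x i ≤ -S.ellBar K x i := by
  have hF := S.norm_closedLoop_sub_le heq hdiff hf
  have hb : 0 ≤ ∑ j, (βf j : ℝ) := Finset.sum_nonneg fun j _ => (βf j).2
  obtain ⟨c₁, hc₁, h₁⟩ := exists_quadratic_drift_le hK (w := fun _ => 1)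
    (fun _ => zero_le_one) hb hF
  obtain ⟨c₂, hc₂, h₂⟩ := exists_quadratic_drift_le hK (w := fun j => (βl j : ℝ))
    (fun j => (βl j).2) hb hF
  obtain ⟨c₃, hc₃, h₃⟩ := exists_linear_drift_le hK (S.q K) hb hF
  set B : ℝ := ∑ j, (βl j : ℝ)
  have hB : 0 ≤ B := Finset.sum_nonneg fun j _ => (βl j).2
  have hsmall : ∀ x ∈ Metric.ball (0 : Vec n) (1 / (2 * (c₁ + 1))),
      ‖x‖ ≤ 1 ∧ c₁ * ‖x‖ ≤ 1 / 2 := by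
    intro x hx
    have hx' : ‖x‖ < 1 / (2 * (c₁ + 1)) := by simpa using hx
    rw [lt_div_iff₀ (by positivity)] at hx'
    have := norm_nonneg x
    constructor <;> nlinarith
  -- The radius keeps the cubic error of the P^I form below half of its decrease, leaving a gain `α
  -- / 4 * ‖x‖ ^ 2` in `Vf`. The threshold makes this gain cover the errors of the P^β form, the
  -- linear form and the stage cost.
  refine ⟨1 / (2 * (c₁ + 1)), by positivity, 4 * (c₂ + B + c₃) + 1, by positivity, ?_, ?_⟩
  · intro i x hx
    obtain ⟨hx1, hx2⟩ := hsmall x hx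
    have h := h₁ i x hx1
    have : c₁ * ‖x‖ * ‖x‖ ^ 2 ≤ 1 / 2 * ‖x‖ ^ 2 := by gcongr
    linarith
  · intro α hα i x hx
    obtain ⟨hx1, hx2⟩ := hsmall x hx
    have hα0 : 0 ≤ α := le_trans (by positivity) hα
    have e₁ := h₁ i x hx1
    have e₂ := h₂ i x hx1
    have e₃ := h₃ i x
    have e₄ := S.ellBar_le hl x i
    have hsq := sq_nonneg ‖x‖
    have hβB : (βl i : ℝ) ≤ B := Finset.single_le_sum (f := fun j => (βl j : ℝ))
      (fun j _ => (βl j).2) (Finset.mem_univ i)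
    rw [generator, drift_eq]
    simp only [S.Vf_eq hK βl hα0]
    have hsplit : ∀ y : Vec n, ∑ j, S.P.1 i j *
        (1 / 2 * (inner ℝ y (lyapOp S.P (S.Gamma K) (fun j => (βl j : ℝ)) j y) +
          α * inner ℝ y (lyapOp S.P (S.Gamma K) (fun _ => 1) j y)) +
          inner ℝ (lyapVec S.P (S.Gamma K) (S.q K) j) y) =
        1 / 2 * (∑ j, S.P.1 i j *
          inner ℝ y (lyapOp S.P (S.Gamma K) (fun j => (βl j : ℝ)) j y)) +
        1 / 2 * α * (∑ j, S.P.1 i j *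
          inner ℝ y (lyapOp S.P (S.Gamma K) (fun _ => 1) j y)) +
        ∑ j, S.P.1 i j * inner ℝ (lyapVec S.P (S.Gamma K) (S.q K) j) y := by
      intro y
      simp only [Finset.mul_sum, ← Finset.sum_add_distrib]
      exact Finset.sum_congr rfl fun j _ => by ring
    rw [hsplit]
    have e₅ : c₂ * ‖x‖ * ‖x‖ ^ 2 ≤ c₂ * ‖x‖ ^ 2 := by
      gcongr
      exact mul_le_of_le_one_right hc₂ hx1
    have e₆ : c₁ * ‖x‖ * ‖x‖ ^ 2 ≤ 1 / 2 * ‖x‖ ^ 2 := by gcongr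
    have e₇ : 1 / 2 * α * (∑ j, S.P.1 i j * inner ℝ (S.closedLoop (kappaF K) x i)
          (lyapOp S.P (S.Gamma K) (fun _ => 1) j (S.closedLoop (kappaF K) x i))) ≤
        1 / 2 * α * (inner ℝ x (lyapOp S.P (S.Gamma K) (fun _ => 1) i x) - 1 / 2 * ‖x‖ ^ 2) := by
      gcongr
      linarith
    have e₈ : (c₂ + B + c₃) * ‖x‖ ^ 2 ≤ 1 / 4 * α * ‖x‖ ^ 2 := by
      gcongr
      linarith
    have e₉ : (βl i : ℝ) * ‖x‖ ^ 2 ≤ B * ‖x‖ ^ 2 := by gcongr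
    have e₁₀ : 0 ≤ c₂ * ‖x‖ ^ 2 := by positivity
    have e₁₁ : 0 ≤ (βl i : ℝ) * ‖x‖ ^ 2 := by positivity
    linarith

end Plant

/-! ### Causal policies and dynamic programming for the horizon cost. -/

namespace Plant

variable {n m ν : ℕ} (S : Plant n m ν)

section OpenLoop

variable {u : ℕ → ModePath ν → Vec m}

theorem dependsOn_openLoop_succ (hu : ∀ k, DependsOn (u k) (Set.Iic k)) (x : Vec n) (k : ℕ) :
    DependsOn (fun ω => S.openLoop x u ω (k + 1)) (Set.Iic k) := by
  induction k with
  | zero =>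
    intro ω ω' h
    simp only [openLoop, hu 0 h, h 0 (Set.mem_Iic.2 le_rfl)]
  | succ k ih =>
    intro ω ω' h
    have h1 := ih fun l hl => h l (Set.mem_Iic.2 (le_trans hl (Nat.le_succ k)))
    change S.f (S.openLoop x u ω (k + 1)) (u (k + 1) ω) (ω (k + 1)) =
      S.f (S.openLoop x u ω' (k + 1)) (u (k + 1) ω') (ω' (k + 1))
    simp only at h1
    simp only [h1, hu (k + 1) h, h (k + 1) (Set.mem_Iic.2 le_rfl)]

theorem dependsOn_openLoop (hu : ∀ k, DependsOn (u k) (Set.Iic k)) (x : Vec n) (k : ℕ) :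
    DependsOn (fun ω => S.openLoop x u ω k) (Set.Iic k) := by
  cases k with
  | zero => exact fun _ _ _ => rfl
  | succ k =>
    exact (S.dependsOn_openLoop_succ hu x k).mono (Set.Iic_subset_Iic.2 (Nat.le_succ k))

theorem dependsOn_openLoop_input_mode {E : Type*} (hu : ∀ k, DependsOn (u k) (Set.Iic k))
    (x : Vec n) (g : Vec n → Vec m → Fin ν → E) (k : ℕ) :
    DependsOn (fun ω => g (S.openLoop x u ω k) (u k ω) (ω k)) (Set.Iic k) := by
  intro ω ω' h
  have h1 := S.dependsOn_openLoop hu x k h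
  simp only at h1
  simp only [h1, hu k h, h k (Set.mem_Iic.2 le_rfl)]

theorem dependsOn_stageCost (hu : ∀ k, DependsOn (u k) (Set.Iic k)) (x : Vec n) {k N : ℕ}
    (hN : ∀ l < N, l ≤ k) :
    DependsOn (fun ω => ∑ l ∈ Finset.range N, S.ell (S.openLoop x u ω l) (u l ω) (ω l))
      (Set.Iic k) := by
  intro ω ω' h
  refine Finset.sum_congr rfl fun l hl => ?_
  exact S.dependsOn_openLoop_input_mode hu x S.ell l fun a ha =>
    h a (Set.mem_Iic.2 (le_trans ha (hN l (Finset.mem_range.1 hl))))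

theorem dependsOn_horizonCost (hu : ∀ k, DependsOn (u k) (Set.Iic k)) (V : Vec n → Fin ν → ℝ)
    (x : Vec n) (N : ℕ) :
    DependsOn (fun ω => V (S.openLoop x u ω N) (ω N) +
      ∑ k ∈ Finset.range N, S.ell (S.openLoop x u ω k) (u k ω) (ω k)) (Set.Iic N) := by
  intro ω ω' h
  have h1 := S.dependsOn_openLoop_input_mode hu x (fun y _ i => V y i) N h
  have h2 := S.dependsOn_stageCost hu x (fun l hl => hl.le) h
  exact congrArg₂ (· + ·) h1 h2

/-- The policy that remains of `u` after the first mode `i`. -/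
def shiftPolicy (i : Fin ν) (u : ℕ → ModePath ν → Vec m) (k : ℕ) (ω : ModePath ν) : Vec m :=
  u (k + 1) (consPath i ω)

theorem openLoop_consPath (x : Vec n) (i : Fin ν) {v : Vec m}
    (hv : ∀ ω, u 0 (consPath i ω) = v) (ω : ModePath ν) (k : ℕ) :
    S.openLoop x u (consPath i ω) (k + 1) =
      S.openLoop (S.f x v i) (shiftPolicy i u) ω k := by
  induction k with
  | zero => simp [openLoop, hv]
  | succ k ih =>
    rw [openLoop, ih]
    rfl

theorem Feasible.dependsOn {N : ℕ} {Xf : Fin ν → Set (Vec n)} {x : Vec n} {i : Fin ν}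
    (h : S.Feasible N Xf x i u) (k : ℕ) : DependsOn (u k) (Set.Iic k) :=
  (h.causal k).dependsOn_of_piLE

/-- The first input of a causal policy is determined by the initial mode. -/
theorem first_input_eq (hu : ∀ k, DependsOn (u k) (Set.Iic k)) {i : Fin ν} {v : Vec m}
    (hv : ∀ᵐ ω ∂(chainLaw S.P i), u 0 ω = v) (ω : ModePath ν) : u 0 (consPath i ω) = v := by
  obtain ⟨ω', h1, h2⟩ := (hv.and (ae_mode_zero S.P i)).exists
  rw [← h1]
  refine hu 0 fun l hl => ?_
  obtain rfl : l = 0 := Nat.le_zero.1 hl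
  exact h2.symm

/-- Constraints hold only almost surely, so they pass to the tail after transitions of positive
probability. -/
theorem Feasible.shift {M : ℕ} {Xf : Fin ν → Set (Vec n)} {x : Vec n} {i j : Fin ν} {v : Vec m}
    (h : S.Feasible (M + 1) Xf x i u) (hv : ∀ᵐ ω ∂(chainLaw S.P i), u 0 ω = v)
    (hij : 0 < S.P.1 i j) : S.Feasible M Xf (S.f x v i) j (shiftPolicy i u) where
  causal k := measurable_of_dependsOn ((h.dependsOn S (k + 1)).consPath i)
  stage := by
    filter_upwards [ae_consPath hij h.stage] with ω hω k hk
    have := hω (k + 1) (by omega)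
    rwa [S.openLoop_consPath x i (S.first_input_eq (h.dependsOn S) hv)] at this
  terminal := by
    filter_upwards [ae_consPath hij h.terminal] with ω hω
    rwa [S.openLoop_consPath x i (S.first_input_eq (h.dependsOn S) hv)] at hω

theorem horizonCost_succ (hu : ∀ k, DependsOn (u k) (Set.Iic k)) (V : Vec n → Fin ν → ℝ)
    (x : Vec n) {i : Fin ν} {v : Vec m} (hv : ∀ ω, u 0 (consPath i ω) = v) (M : ℕ) :
    S.horizonCost (M + 1) V x i u =
      S.ell x v i + ∑ j, S.P.1 i j * S.horizonCost M V (S.f x v i) j (shiftPolicy i u) := by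
  have hs : ∀ k, DependsOn (shiftPolicy i u k) (Set.Iic k) := fun k => (hu (k + 1)).consPath i
  have hterm : ∀ j, ∫ ω, (V (S.openLoop x u (consPath i ω) (M + 1)) (consPath i ω (M + 1)) +
      ∑ k ∈ Finset.range (M + 1), S.ell (S.openLoop x u (consPath i ω) k)
        (u k (consPath i ω)) (consPath i ω k)) ∂(chainLaw S.P j) =
      S.ell x v i + S.horizonCost M V (S.f x v i) j (shiftPolicy i u) := by
    intro j
    have hadd := integral_add (integrable_const (μ := chainLaw S.P j) (S.ell x v i))
      (integrable_of_dependsOn (S.dependsOn_horizonCost hs V (S.f x v i) M) (chainLaw S.P j))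
    rw [integral_const, probReal_univ, one_smul] at hadd
    rw [horizonCost, ← hadd]
    refine integral_congr_ae (Eventually.of_forall fun ω => ?_)
    simp only [Finset.sum_range_succ', S.openLoop_consPath x i hv, consPath_succ, consPath_zero,
      hv]
    simp only [openLoop, shiftPolicy]
    ring
  rw [horizonCost, integral_chainLaw (S.dependsOn_horizonCost hu V x (M + 1))]
  simp only [hterm, smul_eq_mul, mul_add, Finset.sum_add_distrib, ← Finset.sum_mul,
    transition_sum, one_mul]

end OpenLoop

/-! ### Extending policies by the terminal law. -/

section TerminalLaw

variable (K : Fin ν → (Vec n →L[ℝ] Vec m)) {Xf : Fin ν → Set (Vec n)}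

/-- The terminal law, as a policy for the initial state `x`. -/
def terminalPolicy (x : Vec n) (k : ℕ) (ω : ModePath ν) : Vec m :=
  kappaF K (flow (S.closedLoop (kappaF K)) x ω k) (ω k)

theorem openLoop_terminalPolicy (x : Vec n) (ω : ModePath ν) (k : ℕ) :
    S.openLoop x (S.terminalPolicy K x) ω k = flow (S.closedLoop (kappaF K)) x ω k := by
  induction k with
  | zero => rfl
  | succ k ih =>
    rw [openLoop, ih]
    rfl

/-- Follow `v` for `M` steps from the state `y`, then apply the terminal law. -/
def extendPolicy (M : ℕ) (y : Vec n) (v : ℕ → ModePath ν → Vec m) (k : ℕ) (ω : ModePath ν) :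
    Vec m :=
  -- For horizon `M + 1` only `k = M` uses the second branch. There the state under `v` is also the
  -- state under the extended policy, so no recursion is needed.
  if k < M then v k ω else kappaF K (S.openLoop y v ω k) (ω k)

variable {K}

theorem subset_feasibleSet (hUPI : IsUPI S.P (S.closedLoop (kappaF K)) Xf)
    (hadm : ∀ i, ∀ x ∈ Xf i, (x, kappaF K x i) ∈ S.Y i) (N : ℕ) (i : Fin ν) :
    Xf i ⊆ S.feasibleSet N Xf i := by
  intro x hx
  have hmem := ae_flow_mem hUPI.2 hx
  refine ⟨S.terminalPolicy K x, fun k => ?_, ?_, ?_⟩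
  · exact measurable_of_dependsOn (dependsOn_flow_mode _ x (kappaF K) k)
  · filter_upwards [hmem] with ω hω k _
    rw [openLoop_terminalPolicy]
    exact hadm _ _ (hω k)
  · filter_upwards [hmem] with ω hω
    rw [openLoop_terminalPolicy]
    exact hω N

theorem openLoop_extendPolicy (M : ℕ) (y : Vec n) (v : ℕ → ModePath ν → Vec m)
    (ω : ModePath ν) {k : ℕ} (hk : k ≤ M) :
    S.openLoop y (S.extendPolicy K M y v) ω k = S.openLoop y v ω k := by
  induction k with
  | zero => rfl
  | succ k ih =>
    rw [openLoop, openLoop, ih (by omega), extendPolicy, if_pos (by omega)]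

theorem openLoop_extendPolicy_succ (M : ℕ) (y : Vec n) (v : ℕ → ModePath ν → Vec m)
    (ω : ModePath ν) :
    S.openLoop y (S.extendPolicy K M y v) ω (M + 1) =
      S.closedLoop (kappaF K) (S.openLoop y v ω M) (ω M) := by
  rw [openLoop, S.openLoop_extendPolicy M y v ω le_rfl, extendPolicy, if_neg (lt_irrefl M)]
  rfl

/-- The terminal constraint puts the state at time `M` in the terminal family; there the terminal
law is admissible and keeps the next state in the family. -/
theorem Feasible.extend (hUPI : IsUPI S.P (S.closedLoop (kappaF K)) Xf)
    (hadm : ∀ i, ∀ x ∈ Xf i, (x, kappaF K x i) ∈ S.Y i) {M : ℕ} {y : Vec n} {i : Fin ν}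
    {v : ℕ → ModePath ν → Vec m} (h : S.Feasible M Xf y i v) :
    S.Feasible (M + 1) Xf y i (S.extendPolicy K M y v) where
  causal k := by
    refine measurable_of_dependsOn (k := k) ?_
    unfold extendPolicy
    split_ifs
    · exact h.dependsOn S k
    · exact S.dependsOn_openLoop_input_mode (h.dependsOn S) y (fun y _ i => kappaF K y i) k
  stage := by
    filter_upwards [h.stage, h.terminal] with ω h1 h2 k hk
    rw [S.openLoop_extendPolicy M y v ω (by omega), extendPolicy]
    split_ifs with hkM
    · exact h1 k hkM
    · obtain rfl : k = M := by omega
      exact hadm _ _ h2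
  terminal := by
    filter_upwards [h.terminal, ae_transition_pos S.P i] with ω h1 h2
    rw [S.openLoop_extendPolicy_succ]
    exact hUPI.2 _ _ (h2 M) _ h1

/-- The cost accumulated in `N` steps at the equilibrium. -/
noncomputable def equilibriumCost (N : ℕ) (i : Fin ν) : ℝ :=
  ∫ ω, ∑ k ∈ Finset.range N, S.ell 0 0 (ω k) ∂(chainLaw S.P i)

theorem dependsOn_equilibriumCost {k N : ℕ} (hN : ∀ l < N, l ≤ k) :
    DependsOn (fun ω : ModePath ν => ∑ l ∈ Finset.range N, S.ell 0 0 (ω l)) (Set.Iic k) :=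
  fun _ _ h => Finset.sum_congr rfl fun l hl => by
    rw [h l (Set.mem_Iic.2 (hN l (Finset.mem_range.1 hl)))]

theorem equilibriumCost_succ (M : ℕ) (i : Fin ν) :
    S.equilibriumCost (M + 1) i =
      S.ell 0 0 i + ∑ j, S.P.1 i j * S.equilibriumCost M j := by
  have hterm : ∀ j, ∫ ω, ∑ k ∈ Finset.range (M + 1), S.ell 0 0 (consPath i ω k)
      ∂(chainLaw S.P j) = S.ell 0 0 i + S.equilibriumCost M j := by
    intro j
    have hadd := integral_add (integrable_const (μ := chainLaw S.P j) (S.ell 0 0 i))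
      (integrable_of_dependsOn (S.dependsOn_equilibriumCost (k := M) (N := M)
        fun l hl => hl.le) (chainLaw S.P j))
    rw [integral_const, probReal_univ, one_smul] at hadd
    rw [equilibriumCost, ← hadd]
    refine integral_congr_ae (Eventually.of_forall fun ω => ?_)
    simp only [Finset.sum_range_succ', consPath_succ, consPath_zero]
    ring
  rw [equilibriumCost, integral_chainLaw (S.dependsOn_equilibriumCost (k := M + 1)
    fun l hl => hl.le)]
  simp only [hterm, smul_eq_mul, mul_add, Finset.sum_add_distrib, ← Finset.sum_mul,
    transition_sum, one_mul]

/-- Extending a feasible policy by the terminal law costs at most the equilibrium cost of the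
additional step. -/
theorem horizonCost_extendPolicy_le {V : Vec n → Fin ν → ℝ}
    (hdec : ∀ i, ∀ x ∈ Xf i,
      generator S.P (S.closedLoop (kappaF K)) V x i ≤ -S.ellBar K x i)
    {M : ℕ} {y : Vec n} {i : Fin ν} {v : ℕ → ModePath ν → Vec m}
    (h : S.Feasible M Xf y i v) :
    S.horizonCost (M + 1) V y i (S.extendPolicy K M y v) ≤
      S.horizonCost M V y i v + (S.equilibriumCost (M + 1) i - S.equilibriumCost M i) := by
  have hv := h.dependsOn S
  set x : ModePath ν → Vec n := fun ω => S.openLoop y v ω M with hx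
  set F := S.closedLoop (kappaF K)
  have hint : ∀ {E : Type} [NormedAddCommGroup E] (g : Vec n → Fin ν → E),
      Integrable (fun ω => g (x ω) (ω M)) (chainLaw S.P i) := fun g =>
    integrable_of_dependsOn (S.dependsOn_openLoop_input_mode hv y (fun y _ i => g y i) M) _
  have hcost : Integrable (fun ω => ∑ k ∈ Finset.range M,
      S.ell (S.openLoop y v ω k) (v k ω) (ω k)) (chainLaw S.P i) :=
    integrable_of_dependsOn (S.dependsOn_stageCost hv y (k := M) fun l hl => hl.le) _
  have hnext : Integrable (fun ω => V (F (x ω) (ω M)) (ω (M + 1))) (chainLaw S.P i) := by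
    refine integrable_of_dependsOn (k := M + 1) (fun ω ω' hω => ?_) _
    have h1 := S.dependsOn_openLoop_input_mode hv y (fun y _ i => F y i) M
      fun l hl => hω l (Set.mem_Iic.2 (le_trans hl (Nat.le_succ M)))
    exact congrArg₂ V h1 (hω (M + 1) (Set.mem_Iic.2 le_rfl))
  -- Averaging over θ_{M+1} given the past turns the new terminal cost into the generator at time
  -- `M`, where `hdec` applies almost surely.
  have hmarkov : ∫ ω, V (F (x ω) (ω M)) (ω (M + 1)) ∂(chainLaw S.P i) ≤
      ∫ ω, (V (x ω) (ω M) - S.ellBar K (x ω) (ω M)) ∂(chainLaw S.P i) := by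
    rw [integral_markov S.P i (Φ := fun j ω => V (F (x ω) (ω M)) j)
      fun j => S.dependsOn_openLoop_input_mode hv y (fun y _ i => V (F y i) j) M]
    refine integral_mono_ae (hint fun y i => ∑ j, S.P.1 i j • V (F y i) j)
      (hint fun y i => V y i - S.ellBar K y i) ?_
    filter_upwards [h.terminal] with ω hω
    have := hdec _ _ hω
    rw [generator, drift_eq] at this
    simp only [smul_eq_mul]
    linarith
  have hL : S.horizonCost (M + 1) V y i (S.extendPolicy K M y v) =
      ∫ ω, (V (F (x ω) (ω M)) (ω (M + 1)) +
        (∑ k ∈ Finset.range M, S.ell (S.openLoop y v ω k) (v k ω) (ω k) +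
          S.ell (x ω) (kappaF K (x ω) (ω M)) (ω M))) ∂(chainLaw S.P i) := by
    refine integral_congr_ae (Eventually.of_forall fun ω => ?_)
    simp only [S.openLoop_extendPolicy_succ, Finset.sum_range_succ]
    congr 2
    · refine Finset.sum_congr rfl fun k hk => ?_
      have hk := Finset.mem_range.1 hk
      rw [S.openLoop_extendPolicy M y v ω hk.le, extendPolicy, if_pos hk]
    · rw [S.openLoop_extendPolicy M y v ω le_rfl, extendPolicy, if_neg (lt_irrefl M)]
  have hE : S.equilibriumCost (M + 1) i - S.equilibriumCost M i =
      ∫ ω, S.ell 0 0 (ω M) ∂(chainLaw S.P i) := by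
    rw [equilibriumCost, equilibriumCost, ← integral_sub]
    · simp only [Finset.sum_range_succ, add_sub_cancel_left]
    · exact integrable_of_dependsOn (S.dependsOn_equilibriumCost (k := M + 1)
        fun l hl => hl.le) _
    · exact integrable_of_dependsOn (S.dependsOn_equilibriumCost (k := M) fun l hl => hl.le) _
  have h1 := hint fun y i => S.ell y (kappaF K y i) i
  have h2 := hint fun _ i => S.ell 0 0 i
  have h3 := hint V
  have h4 := hint (S.ellBar K)
  have hbar : ∫ ω, S.ellBar K (x ω) (ω M) ∂(chainLaw S.P i) =
      ∫ ω, S.ell (x ω) (kappaF K (x ω) (ω M)) (ω M) ∂(chainLaw S.P i) -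
        ∫ ω, S.ell 0 0 (ω M) ∂(chainLaw S.P i) := integral_sub h1 h2
  rw [integral_sub h3 h4, hbar] at hmarkov
  have h5 : Integrable (fun ω => ∑ k ∈ Finset.range M,
      S.ell (S.openLoop y v ω k) (v k ω) (ω k) + S.ell (x ω) (kappaF K (x ω) (ω M)) (ω M))
      (chainLaw S.P i) := hcost.add h1
  rw [hL, hE, integral_add hnext h5, integral_add hcost h1, horizonCost,
    integral_add h3 hcost]
  linarith

end TerminalLaw

/-! ### Recursive feasibility and stability of the receding horizon loop. -/

section RecedingHorizon

variable {K : Fin ν → (Vec n →L[ℝ] Vec m)} {Xf : Fin ν → Set (Vec n)} {M : ℕ}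
  {V : Vec n → Fin ν → ℝ} {κ : Vec n → Fin ν → Vec m}

/-- Shifting an optimizer loses one step of the horizon; the terminal law restores it. -/
theorem isUPI_feasibleSet (hUPI : IsUPI S.P (S.closedLoop (kappaF K)) Xf)
    (hadm : ∀ i, ∀ x ∈ Xf i, (x, kappaF K x i) ∈ S.Y i)
    (hκ : S.IsMPCLaw (M + 1) V Xf κ) :
    IsUPI S.P (S.closedLoop κ) (S.feasibleSet (M + 1) Xf) := by
  refine ⟨fun i => (hUPI.1 i).mono (S.subset_feasibleSet hUPI hadm (M + 1) i), ?_⟩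
  intro i j hij x hx
  obtain ⟨u, hu, hu0⟩ := hκ i x hx
  exact ⟨_, (hu.1.shift S hu0 hij).extend S hUPI hadm⟩

/-- The storage function is bounded below on the admissible states. -/
theorem exists_storage_lower_bound (hY : ∀ i, IsCompact (S.Y i)) {lam : Vec n → Fin ν → ℝ}
    (hlam : ∀ i, LowerSemicontinuous fun x => lam x i) :
    ∃ c : ℝ, ∀ i x u, (x, u) ∈ S.Y i → c ≤ lam x i := by
  have h : ∀ i, ∃ c : ℝ, ∀ x u, (x, u) ∈ S.Y i → c ≤ lam x i := by
    intro i
    obtain ⟨c, hc⟩ := ((hlam i).lowerSemicontinuousOn _).bddBelow_of_isCompact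
      ((hY i).image continuous_fst)
    exact ⟨c, fun x u hxu => hc ⟨x, ⟨(x, u), hxu, rfl⟩, rfl⟩⟩
  choose c hc using h
  refine ⟨-∑ i, |c i|, fun i x u hxu => le_trans ?_ (hc i x u hxu)⟩
  have := Finset.single_le_sum (f := fun i => |c i|) (fun i _ => abs_nonneg _)
    (Finset.mem_univ i)
  linarith [neg_abs_le (c i)]

/-- Mean square stability of the receding horizon closed loop. -/
theorem isMSStableOn_feasibleSet (hwp : S.WellPosed)
    (hUPI : IsUPI S.P (S.closedLoop (kappaF K)) Xf)
    (hadm : ∀ i, ∀ x ∈ Xf i, (x, kappaF K x i) ∈ S.Y i)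
    (hdec : ∀ i, ∀ x ∈ Xf i,
      generator S.P (S.closedLoop (kappaF K)) V x i ≤ -S.ellBar K x i)
    {cV : ℝ} (hV : ∀ i, ∀ x ∈ Xf i, cV ≤ V x i)
    {lam rho : Vec n → Fin ν → ℝ} {γ : ℝ} (hdiss : S.StrictlyDissipative lam rho)
    (hγ : 0 < γ) (hrho : ∀ x i, γ * ‖x‖ ^ 2 ≤ rho x i)
    (hκ : S.IsMPCLaw (M + 1) V Xf κ) :
    IsMSStableOn S.P (S.closedLoop κ) (S.feasibleSet (M + 1) Xf) := by
  have hinv := S.isUPI_feasibleSet hUPI hadm hκ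
  obtain ⟨cl, hcl⟩ := S.exists_storage_lower_bound hwp.Y_compact hdiss.lam_lsc
  have hY : ∀ i, ∀ x ∈ S.feasibleSet (M + 1) Xf i, (x, κ x i) ∈ S.Y i := by
    intro i x hx
    obtain ⟨u, hu, hu0⟩ := hκ i x hx
    obtain ⟨ω, h1, h2, h3⟩ := (hu.1.stage.and (hu0.and (ae_mode_zero S.P i))).exists
    have := h1 0 (Nat.succ_pos M)
    rwa [h2, h3] at this
  choose! U hU hU0 using hκ
  have hdep := fun i x hx => (hU i x hx).1.dependsOn S
  -- The rotated optimal cost. It is bounded below because stage costs are nonnegative, `V` is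
  -- bounded below on the terminal sets and `lam` on the admissible states.
  refine isMSStableOn_of_lyapunov hinv.2 (fun x i => S.horizonCost (M + 1) V x i (U i x) -
    S.equilibriumCost (M + 1) i + lam x i) (γ := γ)
    (c := cV - ∑ i, |S.equilibriumCost (M + 1) i| + cl) hγ ?_ ?_
  · intro i x hx
    have h1 : cV ≤ S.horizonCost (M + 1) V x i (U i x) := by
      calc cV = ∫ _, cV ∂(chainLaw S.P i) := by simp
        _ ≤ _ := integral_mono_ae (integrable_const cV)
          (integrable_of_dependsOn (S.dependsOn_horizonCost (hdep i x hx) V x (M + 1)) _) (by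
            filter_upwards [(hU i x hx).1.terminal] with ω hω
            have := Finset.sum_nonneg fun k (_ : k ∈ Finset.range (M + 1)) =>
              hwp.ell_nonneg (S.openLoop x (U i x) ω k) (U i x k ω) (ω k)
            linarith [hV _ _ hω])
    have h2 := hcl i x _ (hY i x hx)
    have h3 := Finset.single_le_sum (f := fun i => |S.equilibriumCost (M + 1) i|)
      (fun i _ => abs_nonneg _) (Finset.mem_univ i)
    have h4 := le_abs_self (S.equilibriumCost (M + 1) i)
    linarith
  · intro i x hx
    set y := S.closedLoop κ x i with hy
    have hstep : ∀ j, S.P.1 i j * (S.horizonCost (M + 1) V y j (U j y) -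
        S.equilibriumCost (M + 1) j) ≤
        S.P.1 i j * (S.horizonCost M V y j (shiftPolicy i (U i x)) - S.equilibriumCost M j) := by
      intro j
      -- The successor state need not be feasible in modes of probability zero, so these are
      -- discarded by their weight.
      rcases (transition_nonneg S.P i j).eq_or_lt with h0 | h0
      · simp [← h0]
      · have hshift : S.Feasible M Xf y j (shiftPolicy i (U i x)) :=
          (hU i x hx).1.shift S (hU0 i x hx) h0
        have h1 := (hU j y (hinv.2 i j h0 x hx)).2 _ (hshift.extend S hUPI hadm)
        have h2 := S.horizonCost_extendPolicy_le hdec hshift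
        exact mul_le_mul_of_nonneg_left (by linarith) h0.le
    have hsum := Finset.sum_le_sum fun j (_ : j ∈ Finset.univ) => hstep j
    have hcost := S.horizonCost_succ (hdep i x hx) V x
      (S.first_input_eq (hdep i x hx) (hU0 i x hx)) M
    have heqc := S.equilibriumCost_succ M i
    have hd := hdiss.dissipation i x (κ x i) (hY i x hx)
    rw [drift_eq] at hd
    have hr := hrho x i
    change ∑ j, S.P.1 i j * (S.horizonCost (M + 1) V y j (U j y) -
      S.equilibriumCost (M + 1) j + lam y j) ≤ _
    change S.horizonCost (M + 1) V x i (U i x) = S.ell x (κ x i) i +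
      ∑ j, S.P.1 i j * S.horizonCost M V y j (shiftPolicy i (U i x)) at hcost
    change ∑ j, S.P.1 i j * lam y j - lam x i ≤ _ at hd
    simp only [mul_add (S.P.1 i _), Finset.sum_add_distrib]
    rw [show (∑ j, S.P.1 i j * (S.horizonCost M V y j (shiftPolicy i (U i x)) -
      S.equilibriumCost M j)) = ∑ j, S.P.1 i j * S.horizonCost M V y j (shiftPolicy i (U i x)) -
        ∑ j, S.P.1 i j * S.equilibriumCost M j by
      simp only [mul_sub, Finset.sum_sub_distrib]] at hsum
    linarith

end RecedingHorizon

end Plant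

end EMPC

/-! ### Assembly of the three parts. -/

theorem mainTheorem4 {n m ν : ℕ} (S : Plant n m ν)
    (hwp : S.WellPosed) (heq : S.CommonEquilibrium)
    (hdiff : ∀ i, DifferentiableAt ℝ (fun p : Vec n × Vec m => S.f p.1 p.2 i) 0)
    (K : Fin ν → (Vec n →L[ℝ] Vec m)) (βf βl : Fin ν → ℝ≥0)
    (hf : ∀ i, BetaSmooth (βf i) (fun x => S.closedLoop (Plant.kappaF K) x i))
    (hl : ∀ i, BetaSmooth (βl i) (fun x => S.ellBar K x i))
    (hK : S.IsMSStabilizing K) :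
    -- the terminal cost is well defined and quadratic-plus-linear, for every `α > 0`
    (∃ (PI Pβ : Fin ν → (Vec n →L[ℝ] Vec n)) (p : Fin ν → Vec n),
      (∀ i, (PI i).IsPositive ∧ (Pβ i).IsPositive) ∧
      (∀ i, PI i = ContinuousLinearMap.id ℝ (Vec n) +
        (ContinuousLinearMap.adjoint (S.Gamma K i)).comp
          ((modeAvg S.P PI i).comp (S.Gamma K i))) ∧
      (∀ i, Pβ i = (βl i : ℝ) • ContinuousLinearMap.id ℝ (Vec n) +
        (ContinuousLinearMap.adjoint (S.Gamma K i)).comp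
          ((modeAvg S.P Pβ i).comp (S.Gamma K i))) ∧
      (∀ i, p i = S.q K i + ContinuousLinearMap.adjoint (S.Gamma K i) (modeAvg S.P p i)) ∧
      ∀ α : ℝ, 0 < α → ∀ x i,
        (∀ᵐ ω ∂(chainLaw S.P i), Summable (fun k => S.costTerm K βl α x ω k)) ∧
        Integrable (fun ω => ∑' k, S.costTerm K βl α x ω k) (chainLaw S.P i) ∧
        S.Vf K βl α x i = 1 / 2 * inner ℝ x ((Pβ i + α • PI i) x) + inner ℝ (p i) x) ∧
    ∃ δ : ℝ, 0 < δ ∧ ∃ α₀ : ℝ, 0 < α₀ ∧ ∀ α : ℝ, α₀ ≤ α →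
      -- the terminal decrease condition on the ball
      (∀ i, ∀ x ∈ Metric.ball (0 : Vec n) δ,
        generator S.P (S.closedLoop (Plant.kappaF K)) (S.Vf K βl α) x i ≤ -S.ellBar K x i) ∧
      -- local mean square stability
      ∀ Xf : Fin ν → Set (Vec n),
        IsUPI S.P (S.closedLoop (Plant.kappaF K)) Xf →
        (∀ i, ∀ x ∈ Xf i, (x, Plant.kappaF K x i) ∈ S.Y i) →
        (∀ i, Xf i ⊆ Metric.ball (0 : Vec n) δ) →
        ∀ (lam rho : Vec n → Fin ν → ℝ) (γ : ℝ), S.StrictlyDissipative lam rho →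
          0 < γ → (∀ x i, γ * ‖x‖ ^ 2 ≤ rho x i) →
          IsMSStableOn S.P (S.closedLoop (Plant.kappaF K)) Xf ∧
          ∀ N : ℕ, 1 ≤ N →
            (∀ i, Xf i ⊆ S.feasibleSet N Xf i) ∧
            ∀ κN : Vec n → Fin ν → Vec m, S.IsMPCLaw N (S.Vf K βl α) Xf κN →
              IsUPI S.P (S.closedLoop κN) (S.feasibleSet N Xf) ∧
              IsMSStableOn S.P (S.closedLoop κN) (S.feasibleSet N Xf) := by
  have hpos1 := isPositive_lyapOp (fun _ => 1) (fun _ => zero_le_one) hK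
  have hposβ := isPositive_lyapOp (fun j => (βl j : ℝ)) (fun j => (βl j).2) hK
  refine ⟨⟨lyapOp S.P (S.Gamma K) (fun _ => 1), lyapOp S.P (S.Gamma K) (fun j => βl j),
    lyapVec S.P (S.Gamma K) (S.q K), fun i => ⟨hpos1 i, hposβ i⟩, fun i => ?_,
    fun i => lyapOp_eq _ hK i, fun i => lyapVec_eq _ hK i, fun α hα x i => ?_⟩, ?_⟩
  · simpa only [one_smul] using lyapOp_eq (fun _ => 1) hK i
  · obtain ⟨hsum, hint⟩ := ae_summable_and_integrable_tsum
      (fun k => S.integrable_costTerm (K := K) βl α x i k)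
      (S.summable_integral_norm_costTerm hK βl hα.le x i)
    refine ⟨hsum, hint, ?_⟩
    rw [S.Vf_eq hK βl hα.le, add_apply, smul_apply, inner_add_right, inner_smul_right]
  · obtain ⟨δ, hδ, α₀, hα₀, hquad, hdec⟩ := S.exists_terminal_decrease heq hdiff hf hl hK
    refine ⟨δ, hδ, α₀, hα₀, fun α hα => ⟨hdec α hα, ?_⟩⟩
    intro Xf hUPI hadm hball lam rho γ hdiss hγ hrho
    have hnonneg1 : ∀ i x, 0 ≤ inner ℝ x (lyapOp S.P (S.Gamma K) (fun _ => 1) i x) :=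
      fun i x => (hpos1 i).inner_nonneg_right x
    have hnonnegβ : ∀ i x, 0 ≤ inner ℝ x (lyapOp S.P (S.Gamma K) (fun j => (βl j : ℝ)) i x) :=
      fun i x => (hposβ i).inner_nonneg_right x
    have hα0 : 0 ≤ α := hα₀.le.trans hα
    refine ⟨?_, fun N hN => ⟨S.subset_feasibleSet hUPI hadm N, fun κN hκ => ?_⟩⟩
    -- The P^I form is nonnegative and decreases by `‖x‖ ^ 2 / 2` on the ball, so it is itself a
    -- Lyapunov function here.
    · exact isMSStableOn_of_lyapunov hUPI.2
        (fun x i => inner ℝ x (lyapOp S.P (S.Gamma K) (fun _ => 1) i x)) one_half_pos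
        (fun i x _ => hnonneg1 i x) fun i x hx => hquad i x (hball i hx)
    · obtain ⟨M, rfl⟩ : ∃ M, N = M + 1 := ⟨N - 1, by omega⟩
      refine ⟨S.isUPI_feasibleSet hUPI hadm hκ, ?_⟩
      refine S.isMSStableOn_feasibleSet hwp hUPI hadm (fun i x hx => hdec α hα i x (hball i hx))
        -- The quadratic part of `Vf` is nonnegative, and Cauchy–Schwarz bounds the linear part on
        -- the ball.
        (cV := -((∑ j, ‖lyapVec S.P (S.Gamma K) (S.q K) j‖) * δ)) (fun i x hx => ?_)
        hdiss hγ hrho hκ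
      have hxδ : ‖x‖ ≤ δ := (mem_ball_zero_iff.1 (hball i hx)).le
      have hlin : -((∑ j, ‖lyapVec S.P (S.Gamma K) (S.q K) j‖) * δ) ≤
          inner ℝ (lyapVec S.P (S.Gamma K) (S.q K) i) x := by
        refine le_trans (neg_le_neg ?_) (neg_le_of_abs_le (abs_real_inner_le_norm _ _))
        gcongr
        exact Finset.single_le_sum (f := fun j => ‖lyapVec S.P (S.Gamma K) (S.q K) j‖)
          (fun j _ => norm_nonneg _) (Finset.mem_univ i)
      rw [S.Vf_eq hK βl hα0]
      have := mul_nonneg hα0 (hnonneg1 i x)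
      linarith [hnonnegβ i x]
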